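/- **Setting.** Let $n\ge 1$ and $f\ge 0$ be integers with $n\ge 11f$. Of $n$ nodes, a set $\mathcal C$ of $n-f$ nodes is correct, and the other $f$ nodes are faulty. Node $i\in\mathcal C$ can sample from a distribution $\mathcal D_i$ on a data space $\mathcal X$. The loss $q(\theta,x)$, $\theta\in\mathbb R^d$, is differentiable in $\theta$, and $Q^{(i)}(\theta)=\mathbb E_{x\sim\mathcal D_i}[q(\theta,x)]$, $Q^{(\mathcal C)}=\frac1{|\mathcal C|}\sum_{i\in\mathcal C}Q^{(i)}$. For constants $L>0$, $\sigma>0$, $\zeta\ge 0$, assume for all $\theta,\theta'$: $\|\nabla Q^{(i)}(\theta)-\nabla Q^{(i)}(\theta')\|\le L\|\theta-\theta'\|$ and $\mathbb E_{x\sim\mathcal D_i}\|\nabla q(\theta,x)-\nabla Q^{(i)}(\theta)\|^2\le\sigma^2$ for all $i\in\mathcal C$, and $\frac1{|\mathcal C|}\sum_{i\in\mathcal C}\|\nabla Q^{(i)}(\theta)-\nabla Q^{(\mathcal C)}(\theta)\|^2\le\zeta^2$. Let $Q^*=\inf_\theta Q^{(\mathcal C)}(\theta)>-\infty$. **Algorithm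 (MoNNA with $T$ iterations and one coordination round per iteration).** All correct nodes start from $\theta^{(i)}_0=\theta_0$, $m^{(i)}_{-1}=0$. In iteration $t=0,\dots,T-1$, each $i\in\mathcal C$ draws one fresh sample $x^{(i)}_t\sim\mathcal D_i$ (independent of the past and of the other nodes), and sets $m^{(i)}_t=\beta m^{(i)}_{t-1}+(1-\beta)\nabla q(\theta^{(i)}_t,x^{(i)}_t)$ and $z^{(i)}=\theta^{(i)}_t-\gamma m^{(i)}_t$. Every node broadcasts a vector, the same to all receivers; the vector $z^{(j)}$ of a faulty node $j$ is arbitrary. Node $i$ receives the vectors of $n-f-1$ other nodes, chosen by the adversary, and sets $\theta^{(i)}_{t+1}$ to the average of $z^{(i)}$ and of the $n-2f-1$ received vectors nearest to $z^{(i)}$ (ties broken arbitrarily). The adversary may use all that has happened so far, including the samples of iterations $0,\dots,t$, but not later samples. Finally, node $i$ returns $\hat\theta^{(i)}$, drawn uniformly from $\{\theta^{(i)}_0,\dots,\theta^{(i)}_{T-1}\}$. Put $\Delta=Q^{(\mathcal C)}(\theta_0)-Q^*$, $c_0=12\Delta$, $\alpha=\frac{9.88f}{n-f}$, $\lambda=\frac{9f}{n-f}$,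 $c_1=\frac{18\alpha(1+\alpha)}{(1-\alpha)^2}$, $c_2=72L\left(\frac3{n-f}+2c_1+\frac{9\lambda}2(2c_1+3)\right)$. The parameters are $$\gamma=\min\left\{\frac1{12L},\ \frac1L\sqrt{\frac2{3c_1}},\ \sqrt{\frac{c_0}{c_2LT\sigma^2}}\right\},\qquad \beta=\sqrt{1-12\gamma L},$$ where the second term is omitted if $f=0$ (then $c_1=0$). MoNNA is *$(f,\epsilon)$-resilient* if, for every behavior of the faulty nodes and of the network, $\mathbb E\|\nabla Q^{(\mathcal C)}(\hat\theta^{(i)})\|^2\le\epsilon$ for every $i\in\mathcal C$. **Claim.** Up to terms of higher order in $1/T$, MoNNA is $(f,\epsilon)$-resilient with $$\epsilon\in\mathcal O\left(\sqrt{\frac{\sigma^2(1+f)}{nT}}+\frac fn\zeta^2\right).$$ Precisely, for all $L>0$ and $\Delta$ there is a constant $C>0$, depending only on $L$ and $\Delta$, such that for all $n\geq 1$, $f$, $\sigma>0$, $\zeta\geq 0$ with $n\ge 11f$ the following two statements hold, where $C'$ and $T_0$ depend only on $L,\Delta,n,f,\sigma,\zeta$. 1. There is $C'$ such that for every $T\ge1$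 MoNNA is $(f,\epsilon)$-resilient with $\epsilon=C\left(\sqrt{\frac{\sigma^2(1+f)}{nT}}+\frac fn\zeta^2\right)+\frac{C'}T$. 2. There is $T_0\ge 1$ such that for every $T\ge T_0$ MoNNA is $(f,\epsilon)$-resilient with $\epsilon=C\left(\sqrt{\frac{\sigma^2(1+f)}{nT}}+\frac fn\zeta^2\right)$. Moreover, when it is run for $(1+f)T$ iterations instead, that is, with $(1+f)T$ stochastic gradients per correct node, it is $(f,\epsilon)$-resilient with $\epsilon=C\left(\sqrt{\frac{\sigma^2}{nT}}+\frac fn\zeta^2\right)$, whose first term is the rate of fault-free D-SGD with $T$ gradients per node: the gradient overhead is linear in $f$. -/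

import Mathlib

open MeasureTheory ProbabilityTheory

universe u v

namespace Monna

/-- The parameter space `ℝ^d`, with the Euclidean norm. -/
abbrev Param (d : ℕ) : Type := EuclideanSpace ℝ (Fin d)

/-- A collaborative learning problem over `n` nodes, `f` of which are faulty: a data space `X`, a
point-wise loss `q`, differentiable in the parameter, the data distribution `D i` of every node,
and the set `S` of the `n - f` correct nodes. The distributions attached to faulty nodes are never
used. -/
structure Problem (n f : ℕ) where
  d : ℕ
  X : Type u
  [mX : MeasurableSpace X]
  q : Param d → X → ℝ
  D : Fin n → Measure X
  [prob : ∀ i, IsProbabilityMeasure (D i)]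
  S : Finset (Fin n)
  card_S : S.card + f = n
  measurable_q : Measurable (fun p : Param d × X => q p.1 p.2)
  differentiable_q : ∀ x, Differentiable ℝ (fun θ => q θ x)
  integrable_q : ∀ i ∈ S, ∀ θ, Integrable (q θ) (D i)

attribute [instance] Problem.mX Problem.prob

namespace Problem

variable {n f : ℕ} (p : Problem n f)

/-- The local loss `Q⁽ⁱ⁾(θ) = 𝔼_{x ∼ D i} q(θ, x)`. -/
noncomputable def localLoss (i : Fin n) (θ : Param p.d) : ℝ := ∫ x, p.q θ x ∂(p.D i)

/-- The average loss of the correct nodes. -/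
noncomputable def avgLoss (θ : Param p.d) : ℝ :=
  (p.S.card : ℝ)⁻¹ * ∑ i ∈ p.S, p.localLoss i θ

/-- The gradient in `θ` of the point-wise loss `q(θ, x)`. -/
noncomputable def pointGrad (θ : Param p.d) (x : p.X) : Param p.d := gradient (fun θ' => p.q θ' x) θ

/-- The initial suboptimality `Q(θ₀) - Q*`, where `Q* = inf Q`, for the average loss `Q` of the
correct nodes. -/
noncomputable def gap (θ₀ : Param p.d) : ℝ := p.avgLoss θ₀ - ⨅ θ, p.avgLoss θ

/-- Lipschitz smoothness of the local losses of the correct nodes. -/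
def LipschitzSmooth (L : ℝ) : Prop :=
  ∀ i ∈ p.S, Differentiable ℝ (p.localLoss i) ∧
    ∀ θ₁ θ₂, ‖gradient (p.localLoss i) θ₁ - gradient (p.localLoss i) θ₂‖ ≤ L * ‖θ₁ - θ₂‖

/-- Variance of the local stochastic gradients of the correct nodes at most `σ²`. -/
def BoundedVariance (σ : ℝ) : Prop :=
  ∀ i ∈ p.S, ∀ θ,
    Integrable (fun x => ‖p.pointGrad θ x - gradient (p.localLoss i) θ‖ ^ 2) (p.D i) ∧
    ∫ x, ‖p.pointGrad θ x - gradient (p.localLoss i) θ‖ ^ 2 ∂(p.D i) ≤ σ ^ 2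

/-- `ζ`-heterogeneity of the local losses of the correct nodes. -/
def Heterogeneous (ζ : ℝ) : Prop :=
  ∀ θ, (p.S.card : ℝ)⁻¹ *
    ∑ i ∈ p.S, ‖gradient (p.localLoss i) θ - gradient p.avgLoss θ‖ ^ 2 ≤ ζ ^ 2

end Problem

/-- `y` is a value of nearest neighbor averaging at a node with own vector `z₀` that received the
vectors `z j`, `j ∈ R`: the average of `z₀` and of the `n - 2f - 1` received vectors nearest to
`z₀`, with ties broken arbitrarily (`N` is the set of the indices that are kept). -/
def IsNNA (n f : ℕ) {d : ℕ} (z₀ : Param d) (z : Fin n → Param d) (R : Finset (Fin n))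
    (y : Param d) : Prop :=
  ∃ N ⊆ R, N.card = n - 2 * f - 1 ∧
    (∀ j ∈ N, ∀ k ∈ R \ N, ‖z₀ - z j‖ ≤ ‖z₀ - z k‖) ∧
    y = ((n : ℝ) - 2 * f)⁻¹ • (z₀ + ∑ j ∈ N, z j)

/-- Polyak momentum `m_t = β m_{t-1} + (1 - β) g_t` with `m_{-1} = 0`. -/
noncomputable def momentum {d : ℕ} (β : ℝ) (g : ℕ → Param d) : ℕ → Param d
  | 0 => β • (0 : Param d) + (1 - β) • g 0
  | t + 1 => β • momentum β g t + (1 - β) • g (t + 1)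

/-- An execution of MoNNA on the problem `p`, with initial model `θ₀`, momentum coefficient `β`,
learning rate `γ`, `K` coordination rounds per iteration and `T` iterations `t = 0, …, T - 1`, on a
probability space `(Ω, P)`. The faulty nodes and the asynchronous network are adversarial: they
choose the vectors broadcast by the faulty nodes and the sets of received vectors. -/
structure Execution {n f : ℕ} (p : Problem n f) (θ₀ : Param p.d) (β γ : ℝ) (K T : ℕ)
    {Ω : Type*} [mΩ : MeasurableSpace Ω] (P : Measure Ω) where
  /-- `hist t` is the history of the whole system (faulty nodes and network included) before the
  data points of iteration `t` are drawn. -/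
  hist : Filtration ℕ mΩ
  /-- `sample t i` is the data point drawn by the correct node `i` in iteration `t`. -/
  sample : ℕ → Fin n → Ω → p.X
  /-- `model t i` is the model of the correct node `i` at the beginning of iteration `t`. -/
  model : ℕ → Fin n → Ω → Param p.d
  /-- `vec t k i` is the vector that node `i` broadcasts in round `k + 1` of iteration `t`, that is
  its vector after `k` rounds. It is the same for all receivers, and it is arbitrary if `i` is
  faulty. -/
  vec : ℕ → ℕ → Fin n → Ω → Param p.d
  /-- `received t k i` is the set of the nodes whose vectors are received by the correct node `i`
  in round `k + 1` of iteration `t`. -/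
  received : ℕ → ℕ → Fin n → Ω → Finset (Fin n)
  /-- `outIdx i` is the index of the model that the correct node `i` returns. -/
  outIdx : Fin n → Ω → Fin T
  sample_measurable : ∀ t < T, ∀ i ∈ p.S, Measurable[hist (t + 1)] (sample t i)
  /-- The correct nodes sample independently, each from its own distribution, … -/
  sample_law : ∀ t < T,
    P.map (fun ω (i : p.S) => sample t i ω) = Measure.pi (fun i : p.S => p.D i)
  /-- … and independently of the past. -/
  sample_indep : ∀ t < T, Indep (hist t)
    (MeasurableSpace.comap (fun ω (i : p.S) => sample t i ω) inferInstance) P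
  /-- What the faulty nodes and the network did before iteration `t` depends on the history only:
  the models at the beginning of iteration `t` are part of it. -/
  model_measurable : ∀ t ≤ T, ∀ i ∈ p.S, Measurable[hist t] (model t i)
  model_zero : ∀ i ∈ p.S, ∀ ω, model 0 i ω = θ₀
  /-- Local phase. -/
  vec_zero : ∀ t < T, ∀ i ∈ p.S, ∀ ω, vec t 0 i ω =
    model t i ω - γ • momentum β (fun s => p.pointGrad (model s i ω) (sample s i ω)) t
  /-- A correct node waits for the vectors of `n - f - 1` other nodes. -/
  received_card : ∀ t < T, ∀ k < K, ∀ i ∈ p.S, ∀ ω,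
    i ∉ received t k i ω ∧ (received t k i ω).card = n - f - 1
  /-- Mixing. -/
  vec_succ : ∀ t < T, ∀ k < K, ∀ i ∈ p.S, ∀ ω,
    IsNNA n f (vec t k i ω) (fun j => vec t k j ω) (received t k i ω) (vec t (k + 1) i ω)
  model_succ : ∀ t < T, ∀ i ∈ p.S, ∀ ω, model (t + 1) i ω = vec t K i ω
  /-- The returned index is uniform and independent of everything else. -/
  outIdx_measurable : ∀ i ∈ p.S, Measurable (outIdx i)
  outIdx_law : ∀ i ∈ p.S, ∀ t : Fin T, P (outIdx i ⁻¹' {t}) = (T : ENNReal)⁻¹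
  outIdx_indep : ∀ i ∈ p.S, Indep (hist T) (MeasurableSpace.comap (outIdx i) inferInstance) P

/-- The model returned by the correct node `i`. -/
def Execution.output {n f : ℕ} {p : Problem n f} {θ₀ : Param p.d} {β γ : ℝ} {K T : ℕ}
    {Ω : Type*} [MeasurableSpace Ω] {P : Measure Ω} (e : Execution p θ₀ β γ K T P)
    (i : Fin n) (ω : Ω) : Param p.d :=
  e.model (e.outIdx i ω) i ω

/-- MoNNA, with the given parameters, is `(f, ε)`-resilient on the problem `p`: whatever the faulty
nodes and the network do, every correct node `i` returns `θ̂` with `𝔼 ‖∇Q(θ̂)‖² ≤ ε`. -/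
def Resilient {n f : ℕ} (p : Problem.{u} n f) (θ₀ : Param p.d) (β γ : ℝ) (K T : ℕ)
    (ε : ℝ) : Prop :=
  ∀ (Ω : Type v) [MeasurableSpace Ω] (P : Measure Ω) [IsProbabilityMeasure P]
    (e : Execution p θ₀ β γ K T P), ∀ i ∈ p.S,
    Integrable (fun ω => ‖gradient p.avgLoss (e.output i ω)‖ ^ 2) P ∧
    ∫ ω, ‖gradient p.avgLoss (e.output i ω)‖ ^ 2 ∂P ≤ ε

noncomputable def alpha (n f : ℕ) : ℝ := 9.88 * f / ((n : ℝ) - f)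

noncomputable def lam (n f : ℕ) : ℝ := 9 * f / ((n : ℝ) - f)

noncomputable def c₁ (n f : ℕ) : ℝ := 18 * alpha n f * (1 + alpha n f) / (1 - alpha n f) ^ 2

noncomputable def c₂ (n f : ℕ) (L : ℝ) : ℝ :=
  72 * L * (3 / ((n : ℝ) - f) + 2 * c₁ n f + 9 * lam n f / 2 * (2 * c₁ n f + 3))

/-- The learning rate `γ = min {1/(12L), (1/L) √(2/(3c₁)), √(c₀/(c₂LTσ²))}`, with `c₀ = 12 Δ`. If
`f = 0` then `c₁ = 0`, and the second term, which is then infinite, is left out. -/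
noncomputable def learningRate (n f : ℕ) (L σ Δ : ℝ) (T : ℕ) : ℝ :=
  if f = 0 then min (1 / (12 * L)) (√(12 * Δ / (c₂ n f L * L * T * σ ^ 2)))
  else min (1 / (12 * L))
    (min (1 / L * √(2 / (3 * c₁ n f))) (√(12 * Δ / (c₂ n f L * L * T * σ ^ 2))))

/-- The momentum coefficient `β = √(1 - 12γL)`. -/
noncomputable def momentumCoeff (n f : ℕ) (L σ Δ : ℝ) (T : ℕ) : ℝ :=
  √(1 - 12 * learningRate n f L σ Δ T * L)

/-- On every problem with `n` nodes, `f` of them faulty, that satisfies the three assumptions with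
the constants `L`, `σ`, `ζ`, and for every initial model with suboptimality `Δ`, MoNNA with `K = 1`,
`T` iterations and the learning rate and momentum coefficient above is `(f, ε)`-resilient. -/
def MonnaGuarantee (n f : ℕ) (L σ ζ Δ : ℝ) (T : ℕ) (ε : ℝ) : Prop :=
  ∀ (p : Problem.{u} n f) (θ₀ : Param p.d),
    p.LipschitzSmooth L → p.BoundedVariance σ → p.Heterogeneous ζ →
    BddBelow (Set.range p.avgLoss) → p.gap θ₀ = Δ →
    Resilient.{u, v} p θ₀ (momentumCoeff n f L σ Δ T) (learningRate n f L σ Δ T) 1 T ε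

end Monna

namespace Monna

/-! Robustness is a counting fact. If a node keeps faulty vectors, it has received and discarded at
least as many correct ones, none of them nearer to its own vector, so each kept faulty vector can be
traded for a correct one at the cost of a triangle inequality (`exists_correct_substitute`). Two
sets of kept nodes differ in at most `2f` elements on either side, and Cauchy–Schwarz on these few
elements gives two facts: averaging contracts the spread of the correct vectors by `alpha n f < 1`
(`nna_spread_le`), and it moves their mean, in square, by at most `13 f / (n - f)` times the spread
(`nna_mean_sq_le`).

These two facts are all that is retained of the adversary; they define `Trajectory`, and the
optimization analysis is then deterministic, path by path. Put `κ = 2α(1+α)/(1-α)² = c₁/9`. The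
total spread of the models is at most `κγ²` times that of the momenta, which in turn is bounded by
the spread of the models, the noise and the heterogeneity; for small `γ` this loop closes. The mean
model moves by `-γ d`, and `d - ∇Q` splits into the lag of the noise-free momentum, the averaged
noise and the drift caused by averaging. The lag is controlled by `‖d‖²` with a coefficient small
enough for the descent inequality to absorb it (`sum_sq_momentum_error_le`,
`sum_sq_gradient_mean_le`).

Expectations enter only through second moments of the accumulated noise. Stochastic gradients are
unbiased (`integral_pointGrad`: this is differentiation under the integral, and it follows from the
variance bound and smoothness), and fresh samples are independent of the past, so the noise in a
momentum has second moment at most `(1-β)σ²` at a node and `(1-β)σ²/(n-f)` on average over the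
nodes.

As `1-β ≤ 12γL`, the result is, up to constants, `Δ/(γT) + γLσ²(1+f)/n + (f/n)ζ²`, plus the price of
passing from the mean model to one node, which carries `γ²` and hence is `O(1/T)`. Because `c₂` is
comparable to `L(1+f)/n`, the prescribed `γ` balances the first two terms; the other caps on `γ`
contribute `O(1/T)`, which the main term dominates for large `T`. -/

theorem norm_add_sq_le_two {E : Type*} [SeminormedAddCommGroup E] (u v : E) :
    ‖u + v‖ ^ 2 ≤ 2 * ‖u‖ ^ 2 + 2 * ‖v‖ ^ 2 := by
  nlinarith [norm_add_le u v, norm_nonneg (u + v), sq_nonneg (‖u‖ - ‖v‖)]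

theorem norm_add_sq_le_three {E : Type*} [SeminormedAddCommGroup E] (u v w : E) :
    ‖u + v + w‖ ^ 2 ≤ 3 * ‖u‖ ^ 2 + 3 * ‖v‖ ^ 2 + 3 * ‖w‖ ^ 2 := by
  have h : ‖u + v + w‖ ^ 2 ≤ (‖u‖ + ‖v‖ + ‖w‖) ^ 2 := by gcongr; exact norm_add₃_le
  nlinarith [sq_nonneg (‖u‖ - ‖v‖), sq_nonneg (‖u‖ - ‖w‖), sq_nonneg (‖v‖ - ‖w‖)]

/-! ### Means and mean squared deviations. -/

section Averages

variable {ι E : Type*} [NormedAddCommGroup E] [InnerProductSpace ℝ E]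

/-- The average of the vectors `x i`, `i ∈ S`. -/
noncomputable def mean (S : Finset ι) (x : ι → E) : E := (S.card : ℝ)⁻¹ • ∑ i ∈ S, x i

/-- The mean squared distance of the vectors `x i`, `i ∈ S`, to their average. -/
noncomputable def spread (S : Finset ι) (x : ι → E) : ℝ :=
  (S.card : ℝ)⁻¹ * ∑ i ∈ S, ‖x i - mean S x‖ ^ 2

theorem mean_add (S : Finset ι) (x y : ι → E) :
    mean S (fun i => x i + y i) = mean S x + mean S y := by
  simp [mean, Finset.sum_add_distrib]

theorem mean_sub (S : Finset ι) (x y : ι → E) :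
    mean S (fun i => x i - y i) = mean S x - mean S y := by
  simp [mean, Finset.sum_sub_distrib, smul_sub]

theorem mean_smul (S : Finset ι) (c : ℝ) (x : ι → E) :
    mean S (fun i => c • x i) = c • mean S x := by
  simp only [mean, ← Finset.smul_sum]
  rw [smul_comm]

theorem mean_const {S : Finset ι} (hS : S.Nonempty) (c : E) : mean S (fun _ => c) = c := by
  have : (S.card : ℝ) ≠ 0 := by simpa using hS.ne_empty
  rw [mean, Finset.sum_const, ← Nat.cast_smul_eq_nsmul ℝ, smul_smul, inv_mul_cancel₀ this, one_smul]

theorem mean_congr {S : Finset ι} {x y : ι → E} (h : ∀ i ∈ S, x i = y i) :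
    mean S x = mean S y := by
  rw [mean, mean, Finset.sum_congr rfl h]

theorem spread_congr {S : Finset ι} {x y : ι → E} (h : ∀ i ∈ S, x i = y i) :
    spread S x = spread S y := by
  rw [spread, spread, mean_congr h]
  congr 1
  exact Finset.sum_congr rfl fun i hi => by rw [h i hi]

theorem spread_nonneg (S : Finset ι) (x : ι → E) : 0 ≤ spread S x :=
  mul_nonneg (by positivity) (Finset.sum_nonneg fun _ _ => by positivity)

theorem card_mul_spread {S : Finset ι} (hS : S.Nonempty) (x : ι → E) :
    S.card * spread S x = ∑ i ∈ S, ‖x i - mean S x‖ ^ 2 := by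
  have : (S.card : ℝ) ≠ 0 := by simpa using hS.ne_empty
  rw [spread, mul_inv_cancel_left₀ this]

theorem sum_sub_mean {S : Finset ι} (hS : S.Nonempty) (x : ι → E) :
    ∑ i ∈ S, (x i - mean S x) = 0 := by
  have : (S.card : ℝ) ≠ 0 := by simpa using hS.ne_empty
  rw [Finset.sum_sub_distrib, Finset.sum_const, ← Nat.cast_smul_eq_nsmul ℝ, mean, smul_smul,
    mul_inv_cancel₀ this, one_smul, sub_self]

/-- Bias–variance decomposition: the cross terms vanish because the deviations from the mean sum to
zero. -/
theorem sum_norm_sub_sq {S : Finset ι} (hS : S.Nonempty) (x : ι → E) (c : E) :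
    ∑ i ∈ S, ‖x i - c‖ ^ 2 = S.card * spread S x + S.card * ‖mean S x - c‖ ^ 2 := by
  have h : ∀ i, ‖x i - c‖ ^ 2 = ‖x i - mean S x‖ ^ 2
      + 2 * inner ℝ (x i - mean S x) (mean S x - c) + ‖mean S x - c‖ ^ 2 := fun i => by
    rw [← norm_add_sq_real]; congr 2; abel
  rw [card_mul_spread hS, Finset.sum_congr rfl fun i _ => h i, Finset.sum_add_distrib,
    Finset.sum_add_distrib, ← Finset.mul_sum, ← sum_inner, sum_sub_mean hS]
  simp

theorem spread_le {S : Finset ι} (hS : S.Nonempty) (x : ι → E) (c : E) :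
    spread S x ≤ (S.card : ℝ)⁻¹ * ∑ i ∈ S, ‖x i - c‖ ^ 2 := by
  have : (0 : ℝ) < S.card := by exact_mod_cast hS.card_pos
  rw [sum_norm_sub_sq hS, mul_add, inv_mul_cancel_left₀ this.ne']
  have : 0 ≤ (S.card : ℝ)⁻¹ * (S.card * ‖mean S x - c‖ ^ 2) := by positivity
  linarith

theorem norm_mean_sub_sq_le {S : Finset ι} (hS : S.Nonempty) (x : ι → E) (c : E) :
    ‖mean S x - c‖ ^ 2 ≤ (S.card : ℝ)⁻¹ * ∑ i ∈ S, ‖x i - c‖ ^ 2 := by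
  have : (0 : ℝ) < S.card := by exact_mod_cast hS.card_pos
  rw [sum_norm_sub_sq hS, mul_add, inv_mul_cancel_left₀ this.ne', inv_mul_cancel_left₀ this.ne']
  linarith [spread_nonneg S x]

theorem norm_sub_mean_sq_le {S : Finset ι} {i : ι} (hi : i ∈ S) (x : ι → E) :
    ‖x i - mean S x‖ ^ 2 ≤ S.card * spread S x := by
  rw [card_mul_spread ⟨i, hi⟩]
  exact Finset.single_le_sum (f := fun j => ‖x j - mean S x‖ ^ 2)
    (fun _ _ => by positivity) hi

/-- Turns bounds on pairwise distances, which are natural for nearest neighbor averaging, into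
bounds on the spread. -/
theorem sum_sum_norm_sub_sq {S : Finset ι} (hS : S.Nonempty) (x : ι → E) :
    ∑ j ∈ S, ∑ i ∈ S, ‖x i - x j‖ ^ 2 = 2 * S.card * (S.card * spread S x) := by
  rw [Finset.sum_congr rfl fun j _ => sum_norm_sub_sq hS x (x j), Finset.sum_add_distrib,
    Finset.sum_const, ← Finset.mul_sum]
  simp_rw [norm_sub_rev (mean S x)]
  rw [← card_mul_spread hS]
  simp; ring

/-- The spread of a combination, from a bound that holds for all pairs of vectors. -/
theorem spread_comb_le (S : Finset ι) (x y : ι → E) {a b p q c : ℝ}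
    (h : ∀ u v : E, c * ‖p • u + q • v‖ ^ 2 ≤ a * ‖u‖ ^ 2 + b * ‖v‖ ^ 2) :
    c * spread S (fun i => p • x i + q • y i) ≤ a * spread S x + b * spread S y := by
  have hm : mean S (fun i => p • x i + q • y i) = p • mean S x + q • mean S y := by
    rw [mean_add, mean_smul, mean_smul]
  have e : ∀ i, p • x i + q • y i - (p • mean S x + q • mean S y)
      = p • (x i - mean S x) + q • (y i - mean S y) := fun i => by
    rw [smul_sub, smul_sub]; abel
  have key : c * ∑ i ∈ S, ‖p • x i + q • y i - (p • mean S x + q • mean S y)‖ ^ 2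
      ≤ a * ∑ i ∈ S, ‖x i - mean S x‖ ^ 2 + b * ∑ i ∈ S, ‖y i - mean S y‖ ^ 2 := by
    simp only [Finset.mul_sum, ← Finset.sum_add_distrib]
    exact Finset.sum_le_sum fun i _ => by rw [e]; exact h _ _
  have := mul_le_mul_of_nonneg_left key (show 0 ≤ (S.card : ℝ)⁻¹ by positivity)
  simp only [spread, hm]
  linarith

theorem norm_convexComb_sq_le {β : ℝ} (h0 : 0 ≤ β) (h1 : β ≤ 1) (u v : E) :
    ‖β • u + (1 - β) • v‖ ^ 2 ≤ β * ‖u‖ ^ 2 + (1 - β) * ‖v‖ ^ 2 := by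
  have h : ‖β • u + (1 - β) • v‖ ≤ β * ‖u‖ + (1 - β) * ‖v‖ := by
    refine (norm_add_le _ _).trans_eq ?_
    rw [norm_smul, norm_smul, Real.norm_of_nonneg h0, Real.norm_of_nonneg (by linarith)]
  have h2 : ‖β • u + (1 - β) • v‖ ^ 2 ≤ (β * ‖u‖ + (1 - β) * ‖v‖) ^ 2 := by gcongr
  nlinarith [mul_nonneg (mul_nonneg h0 (sub_nonneg.2 h1)) (sq_nonneg (‖u‖ - ‖v‖))]

theorem spread_add_le (S : Finset ι) (x y : ι → E) :
    spread S (fun i => x i + y i) ≤ 2 * spread S x + 2 * spread S y := by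
  have := spread_comb_le (c := 1) (p := 1) (q := 1) S x y (fun u v => by
    simpa using norm_add_sq_le_two u v)
  simpa using this

theorem spread_convexComb_le {β : ℝ} (h0 : 0 ≤ β) (h1 : β ≤ 1) (S : Finset ι) (x y : ι → E) :
    spread S (fun i => β • x i + (1 - β) • y i) ≤ β * spread S x + (1 - β) * spread S y := by
  simpa using spread_comb_le (c := 1) S x y (fun u v => by
    simpa using norm_convexComb_sq_le h0 h1 u v)

/-- The spread after a gradient step, contracted by a factor `α < 1`. -/
theorem mul_spread_sub_smul_le {α : ℝ} (h0 : 0 ≤ α) (h1 : α < 1) (γ : ℝ) (S : Finset ι)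
    (x y : ι → E) :
    α * spread S (fun i => x i - γ • y i)
      ≤ (1 + α) / 2 * spread S x + α * (1 + α) / (1 - α) * γ ^ 2 * spread S y := by
  have := spread_comb_le (c := α) (p := 1) (q := -γ) (a := (1 + α) / 2)
    (b := α * (1 + α) / (1 - α) * γ ^ 2) S x y (fun u v => by
      have hn : ‖(1 : ℝ) • u + (-γ) • v‖ ≤ ‖u‖ + |γ| * ‖v‖ := by
        refine (norm_add_le _ _).trans_eq ?_
        rw [one_smul, norm_smul, Real.norm_eq_abs, abs_neg]
      have h1' : 0 < 1 - α := by linarith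
      have h2 : ‖(1 : ℝ) • u + (-γ) • v‖ ^ 2 ≤ (‖u‖ + |γ| * ‖v‖) ^ 2 := by gcongr
      -- Young's inequality as an exact square; its weight is chosen so that the contraction factor
      -- `α` degrades only to `(1 + α) / 2 < 1`.
      have h3 : (1 + α) / 2 * ‖u‖ ^ 2 + α * (1 + α) / (1 - α) * γ ^ 2 * ‖v‖ ^ 2
          - α * (‖u‖ + |γ| * ‖v‖) ^ 2
          = (1 - α) / 2 * (‖u‖ - 2 * α / (1 - α) * (|γ| * ‖v‖)) ^ 2 := by
        rw [← sq_abs γ]; field_simp; ring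
      have h4 : 0 ≤ (1 - α) / 2 * (‖u‖ - 2 * α / (1 - α) * (|γ| * ‖v‖)) ^ 2 := by positivity
      nlinarith [mul_le_mul_of_nonneg_left h2 h0])
  simpa [sub_eq_add_neg] using this

end Averages

/-! ### Summation of linear recursions. -/

section Recursions

/-- Summing a linear recursion with contraction factor `ρ`. -/
theorem sum_le_of_recursion {u v : ℕ → ℝ} {ρ : ℝ} {T : ℕ}
    (h : ∀ t < T, u (t + 1) ≤ ρ * u t + v t) :
    (1 - ρ) * ∑ t ∈ Finset.range T, u t + u T ≤ u 0 + ∑ t ∈ Finset.range T, v t := by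
  induction T with
  | zero => simp
  | succ T ih =>
    have := ih fun t ht => h t (by omega)
    rw [Finset.sum_range_succ, Finset.sum_range_succ]
    linarith [h T (by omega)]

/-- The sum over the shifted indices `1, …, T`, as needed for momenta, which already contain the
gradient of the current iteration. -/
theorem sum_succ_le_of_recursion {u v : ℕ → ℝ} {ρ : ℝ} {T : ℕ}
    (h : ∀ t < T, u (t + 1) ≤ ρ * u t + v t) :
    (1 - ρ) * ∑ t ∈ Finset.range T, u (t + 1) + ρ * u T
      ≤ ρ * u 0 + ∑ t ∈ Finset.range T, v t := by
  induction T with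
  | zero => simp
  | succ T ih =>
    have := ih fun t ht => h t (by omega)
    rw [Finset.sum_range_succ, Finset.sum_range_succ]
    linarith [h T (by omega)]

end Recursions

/-! ### Momentum as an exponential moving average. -/

section ExponentialAverage

variable {ι E : Type*} [NormedAddCommGroup E] [InnerProductSpace ℝ E]

/-- The exponential moving average of `g 0, …, g (t - 1)`. -/
noncomputable def ema (β : ℝ) (g : ℕ → E) : ℕ → E
  | 0 => 0
  | t + 1 => β • ema β g t + (1 - β) • g t

/-- Shifting the index by one makes the convention `m_{-1} = 0` the value at `0`, so recursions need
no special first step. -/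
theorem momentum_eq_ema {d : ℕ} (β : ℝ) (g : ℕ → Param d) (t : ℕ) :
    momentum β g t = ema β g (t + 1) := by
  induction t with
  | zero => rfl
  | succ t ih => rw [momentum, ih, ema]; rfl

theorem ema_add (β : ℝ) (g k : ℕ → E) (t : ℕ) :
    ema β (fun s => g s + k s) t = ema β g t + ema β k t := by
  induction t with
  | zero => simp [ema]
  | succ t ih => simp only [ema, ih, smul_add]; abel

theorem mean_ema (S : Finset ι) (β : ℝ) (g : ℕ → ι → E) (t : ℕ) :
    mean S (fun i => ema β (fun s => g s i) t) = ema β (fun s => mean S (g s)) t := by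
  induction t with
  | zero => simp [ema, mean]
  | succ t ih => simp only [ema, mean_add, mean_smul, ih]

/-- The momentum does not have a larger total spread than the vectors it is built from. -/
theorem sum_spread_ema_le {β : ℝ} (h0 : 0 ≤ β) (h1 : β < 1) (S : Finset ι) (g : ℕ → ι → E)
    (T : ℕ) :
    ∑ t ∈ Finset.range T, spread S (fun i => ema β (fun s => g s i) (t + 1))
      ≤ ∑ t ∈ Finset.range T, spread S (g t) := by
  have := sum_succ_le_of_recursion (T := T) (ρ := β)
    (u := fun t => spread S (fun i => ema β (fun s => g s i) t))
    (v := fun t => (1 - β) * spread S (g t))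
    (fun t _ => spread_convexComb_le h0 h1.le S _ _)
  have hz : spread S (fun i => ema β (fun s => g s i) 0) = 0 := by simp [spread, mean, ema]
  rw [hz, mul_zero, zero_add, ← Finset.mul_sum] at this
  have h2 := mul_nonneg h0 (spread_nonneg S (fun i => ema β (fun s => g s i) T))
  exact le_of_mul_le_mul_left (by linarith) (sub_pos.2 h1)

end ExponentialAverage

/-! ### Contraction and drift of nearest neighbor averaging. -/

section NearestNeighborAveraging

theorem sum_le_sum_of_card_eq {ι : Type*} {A B : Finset ι} {u v : ι → ℝ} (hc : A.card = B.card)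
    (h : ∀ a ∈ A, ∀ b ∈ B, u a ≤ v b) : ∑ a ∈ A, u a ≤ ∑ b ∈ B, v b := by
  rcases A.eq_empty_or_nonempty with rfl | hA
  · have : B = ∅ := by simpa using hc.symm
    simp [this]
  · obtain ⟨a, ha, hmax⟩ := A.exists_max_image u hA
    calc ∑ a ∈ A, u a ≤ A.card • u a := Finset.sum_le_card_nsmul _ _ _ hmax
      _ = B.card • u a := by rw [hc]
      _ ≤ ∑ b ∈ B, v b := Finset.card_nsmul_le_sum _ _ _ fun b hb => h a ha b hb

variable {n f d : ℕ}

/-- A faulty vector that is kept is no farther than some correct vector that is not: the total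
norm of a set of kept vectors is controlled by that of a set of correct vectors of the same size. -/
theorem exists_correct_substitute {S R N : Finset (Fin n)} {i : Fin n} {x : Fin n → Param d}
    (hn : 1 ≤ n) (hf : 11 * f ≤ n) (hS : S.card + f = n) (hi : i ∈ S) (hiR : i ∉ R) (hR : R.card = n - f - 1)
    (hNR : N ⊆ R) (hN : N.card = n - 2 * f - 1)
    (hnear : ∀ j ∈ N, ∀ k ∈ R \ N, ‖x i - x j‖ ≤ ‖x i - x k‖) (c : Param d)
    {A : Finset (Fin n)} (hA : A ⊆ insert i N) :
    ∃ A' ⊆ S, A'.card = A.card ∧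
      ∑ k ∈ A, ‖x k - c‖ ≤ ∑ k ∈ A', ‖x k - c‖ + 2 * (A \ S).card * ‖x i - c‖ := by
  have hAN : A \ S ⊆ N \ S := fun k hk => by
    rw [Finset.mem_sdiff] at hk ⊢
    refine ⟨(Finset.mem_insert.1 (hA hk.1)).resolve_left ?_, hk.2⟩
    rintro rfl
    exact hk.2 hi
  -- Exactly `f` received vectors are discarded. At most `f` nodes are faulty, so faulty kept ones
  -- and faulty discarded ones together number at most `f`; hence at least as many correct vectors
  -- are discarded as faulty ones are kept.
  have hle : (A \ S).card ≤ ((R \ N) ∩ S).card := by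
    have h1 : (R \ N).card = f := by rw [Finset.card_sdiff_of_subset hNR]; omega
    have h2 : ((R \ N) \ S ∪ N \ S).card ≤ Sᶜ.card := Finset.card_le_card fun k hk => by
      simp only [Finset.mem_union, Finset.mem_sdiff, Finset.mem_compl] at hk ⊢; tauto
    rw [Finset.card_union_of_disjoint, Finset.card_compl, Fintype.card_fin] at h2
    · have h3 := Finset.card_inter_add_card_sdiff (R \ N) S
      have h4 := Finset.card_le_card hAN
      omega
    · rw [Finset.disjoint_left]
      intro k hk hk'
      simp only [Finset.mem_sdiff] at hk hk'
      tauto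
  obtain ⟨B, hB, hBc⟩ := Finset.exists_subset_card_eq hle
  have hdisj : Disjoint (A ∩ S) B := by
    rw [Finset.disjoint_left]
    intro k hk hkB
    have h1 := hB hkB
    simp only [Finset.mem_inter, Finset.mem_sdiff] at hk h1
    rcases Finset.mem_insert.1 (hA hk.1) with rfl | h
    · exact hiR h1.1.1
    · exact h1.1.2 h
  refine ⟨A ∩ S ∪ B, Finset.union_subset Finset.inter_subset_right
    (hB.trans Finset.inter_subset_right), ?_, ?_⟩
  · rw [Finset.card_union_of_disjoint hdisj, hBc, Finset.card_inter_add_card_sdiff]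
  -- The distances compared by the selection rule are taken from `x i`; going from `c` to `x i` and
  -- back costs `‖x i - c‖` twice per exchanged vector.
  · have h1 : ∑ k ∈ A \ S, ‖x i - x k‖ ≤ ∑ k ∈ B, ‖x i - x k‖ :=
      sum_le_sum_of_card_eq hBc.symm fun a ha b hb =>
        hnear a (Finset.mem_sdiff.1 (hAN ha)).1 b (Finset.mem_inter.1 (hB hb)).1
    have h2 : ∑ k ∈ A \ S, ‖x k - c‖
        ≤ ∑ k ∈ A \ S, ‖x i - x k‖ + (A \ S).card * ‖x i - c‖ := by
      rw [← nsmul_eq_mul, ← Finset.sum_const, ← Finset.sum_add_distrib]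
      refine Finset.sum_le_sum fun k _ => ?_
      rw [norm_sub_rev (x i)]
      simpa using norm_sub_le_norm_sub_add_norm_sub (x k) (x i) c
    have h3 : ∑ k ∈ B, ‖x i - x k‖ ≤ ∑ k ∈ B, ‖x k - c‖ + (A \ S).card * ‖x i - c‖ := by
      rw [← hBc, ← nsmul_eq_mul, ← Finset.sum_const, ← Finset.sum_add_distrib]
      refine Finset.sum_le_sum fun k _ => ?_
      rw [norm_sub_rev (x k) c, add_comm]
      simpa using norm_sub_le_norm_sub_add_norm_sub (x i) c (x k)
    rw [Finset.sum_union hdisj, ← Finset.sum_inter_add_sum_sdiff A S]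
    linarith

theorem sq_sum_norm_le {S A : Finset (Fin n)} (hA : A ⊆ S) {a : ℝ} (hc : (A.card : ℝ) ≤ a)
    (x : Fin n → Param d) (c : Param d) :
    (∑ k ∈ A, ‖x k - c‖) ^ 2 ≤ a * ∑ k ∈ S, ‖x k - c‖ ^ 2 := by
  refine (sq_sum_le_card_mul_sum_sq (s := A) (f := fun k => ‖x k - c‖)).trans ?_
  have := Finset.sum_le_sum_of_subset_of_nonneg hA (f := fun k => ‖x k - c‖ ^ 2)
    (fun _ _ _ => by positivity)
  have h0 : 0 ≤ ∑ k ∈ A, ‖x k - c‖ ^ 2 := Finset.sum_nonneg fun _ _ => by positivity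
  have ha : 0 ≤ a := le_trans (by positivity) hc
  exact mul_le_mul hc this h0 ha

/-- The set `K` of the `n - 2f` nodes whose vectors are averaged by node `i`. -/
theorem IsNNA.exists_kept {S R : Finset (Fin n)} {i : Fin n} {x : Fin n → Param d} {y : Param d}
    (hn : 1 ≤ n) (hf : 11 * f ≤ n) (hS : S.card + f = n) (hi : i ∈ S) (hiR : i ∉ R)
    (hR : R.card = n - f - 1) (h : IsNNA n f (x i) x R y) :
    ∃ K : Finset (Fin n), K.card = n - 2 * f ∧ ((n : ℝ) - 2 * f) • y = ∑ k ∈ K, x k ∧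
      ∀ (c : Param d), ∀ A ⊆ K, ∃ A' ⊆ S, A'.card = A.card ∧
        ∑ k ∈ A, ‖x k - c‖ ≤ ∑ k ∈ A', ‖x k - c‖ + 2 * (A \ S).card * ‖x i - c‖ := by
  obtain ⟨N, hNR, hN, hnear, rfl⟩ := h
  have hiN : i ∉ N := fun h => hiR (hNR h)
  refine ⟨insert i N, ?_, ?_, fun c A hA =>
    exists_correct_substitute hn hf hS hi hiR hR hNR hN hnear c hA⟩
  · rw [Finset.card_insert_of_notMem hiN]; omega
  · have : (n : ℝ) - 2 * f ≠ 0 := by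
      have h1 : (1 : ℝ) ≤ n := by exact_mod_cast hn
      have h2 : (11 : ℝ) * f ≤ n := by exact_mod_cast hf
      linarith
    rw [smul_inv_smul₀ this, Finset.sum_insert hiN]

theorem card_sdiff_le_of_card_eq {A B : Finset (Fin n)} (hA : A.card = n - 2 * f)
    (hB : B.card = n - 2 * f) : (A \ B).card ≤ 2 * f := by
  have h1 : (A \ B ∪ B).card ≤ n := by simpa using Finset.card_le_univ (A \ B ∪ B)
  rw [Finset.card_union_of_disjoint Finset.sdiff_disjoint] at h1
  have h2 : (A \ B).card ≤ A.card := Finset.card_le_card Finset.sdiff_subset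
  omega

theorem card_le_of_disjoint {S A : Finset (Fin n)} (hS : S.card + f = n) (hA : Disjoint A S) :
    A.card ≤ f := by
  have h1 : (A ∪ S).card ≤ n := by simpa using Finset.card_le_univ (A ∪ S)
  rw [Finset.card_union_of_disjoint hA] at h1
  omega

variable {S : Finset (Fin n)} {R : Fin n → Finset (Fin n)} {x y : Fin n → Param d}

/-- A node broadcasts one and the same vector, so vectors kept by both `i` and `j`, faulty ones
included, cancel in `y i - y j`. Only the two set differences remain, each of size at most `2f`, and
their faulty members are exchanged for correct ones. -/
theorem nna_dist_sq_le (hn : 1 ≤ n) (hf : 11 * f ≤ n) (hS : S.card + f = n)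
    (hR : ∀ i ∈ S, i ∉ R i ∧ (R i).card = n - f - 1) (h : ∀ i ∈ S, IsNNA n f (x i) x (R i) (y i))
    (c : Param d) {i j : Fin n} (hi : i ∈ S) (hj : j ∈ S) :
    ((n : ℝ) - 2 * f) ^ 2 * ‖y i - y j‖ ^ 2
      ≤ 32 / 3 * f * ∑ k ∈ S, ‖x k - c‖ ^ 2
        + 16 * f ^ 2 * (‖x i - c‖ ^ 2 + ‖x j - c‖ ^ 2) := by
  obtain ⟨K, hK, hy, hsub⟩ := (h i hi).exists_kept hn hf hS hi (hR i hi).1 (hR i hi).2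
  obtain ⟨M, hM, hy', hsub'⟩ := (h j hj).exists_kept hn hf hS hj (hR j hj).1 (hR j hj).2
  obtain ⟨A, hA, hAc, hle⟩ := hsub c (K \ M) Finset.sdiff_subset
  obtain ⟨B, hB, hBc, hle'⟩ := hsub' c (M \ K) Finset.sdiff_subset
  have hKM := card_sdiff_le_of_card_eq hK hM
  have hMK := card_sdiff_le_of_card_eq hM hK
  have hP := sq_sum_norm_le (a := 2 * f) hA (by rw [hAc]; exact_mod_cast hKM) x c
  have hP' := sq_sum_norm_le (a := 2 * f) hB (by rw [hBc]; exact_mod_cast hMK) x c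
  -- The two groups of faulty nodes are disjoint, so both exchanges together involve at most `f`
  -- faulty vectors.
  have hb : ((((K \ M) \ S).card : ℝ) + ((M \ K) \ S).card) ≤ f := by
    have hd : Disjoint ((K \ M) \ S) ((M \ K) \ S) := by
      rw [Finset.disjoint_left]
      intro k hk hk'
      simp only [Finset.mem_sdiff] at hk hk'
      tauto
    have := card_le_of_disjoint hS (A := (K \ M) \ S ∪ (M \ K) \ S) (by
      rw [Finset.disjoint_left]
      intro k hk
      simp only [Finset.mem_union, Finset.mem_sdiff] at hk
      tauto)
    rw [Finset.card_union_of_disjoint hd] at this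
    exact_mod_cast this
  have hcard : (K \ M).card = (M \ K).card := by
    have h1 := Finset.card_sdiff_add_card_inter K M
    have h2 := Finset.card_sdiff_add_card_inter M K
    rw [Finset.inter_comm M K] at h2
    omega
  have hdiff : ((n : ℝ) - 2 * f) • (y i - y j)
      = ∑ k ∈ K \ M, (x k - c) - ∑ k ∈ M \ K, (x k - c) := by
    rw [smul_sub, hy, hy', ← Finset.sum_sdiff_sub_sum_sdiff, Finset.sum_sub_distrib,
      Finset.sum_sub_distrib, Finset.sum_const, Finset.sum_const, hcard]
    abel
  set W := ∑ k ∈ S, ‖x k - c‖ ^ 2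
  set b : ℝ := (((K \ M) \ S).card : ℝ)
  set b' : ℝ := (((M \ K) \ S).card : ℝ)
  set P := ∑ k ∈ A, ‖x k - c‖
  set P' := ∑ k ∈ B, ‖x k - c‖
  have hb0 : 0 ≤ b := Nat.cast_nonneg _
  have hb0' : 0 ≤ b' := Nat.cast_nonneg _
  have hnorm : |(n : ℝ) - 2 * f| * ‖y i - y j‖
      ≤ (P + P') + 2 * (b * ‖x i - c‖ + b' * ‖x j - c‖) := by
    rw [← Real.norm_eq_abs, ← norm_smul, hdiff]
    have h1 := norm_sub_le (∑ k ∈ K \ M, (x k - c)) (∑ k ∈ M \ K, (x k - c))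
    have h2 := norm_sum_le (K \ M) (fun k => x k - c)
    have h3 := norm_sum_le (M \ K) (fun k => x k - c)
    linarith
  have hsq : ((n : ℝ) - 2 * f) ^ 2 * ‖y i - y j‖ ^ 2
      ≤ ((P + P') + 2 * (b * ‖x i - c‖ + b' * ‖x j - c‖)) ^ 2 := by
    rw [← sq_abs ((n : ℝ) - 2 * f), ← mul_pow]
    gcongr
  have h1 : (b * ‖x i - c‖ + b' * ‖x j - c‖) ^ 2
      ≤ f ^ 2 * (‖x i - c‖ ^ 2 + ‖x j - c‖ ^ 2) := by
    have hbb : b ^ 2 + b' ^ 2 ≤ (f : ℝ) ^ 2 := by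
      have h5 : (b + b') ^ 2 ≤ (f : ℝ) ^ 2 := by gcongr
      nlinarith [mul_nonneg hb0 hb0']
    calc (b * ‖x i - c‖ + b' * ‖x j - c‖) ^ 2
        ≤ (b ^ 2 + b' ^ 2) * (‖x i - c‖ ^ 2 + ‖x j - c‖ ^ 2) := by
          nlinarith [sq_nonneg (b * ‖x j - c‖ - b' * ‖x i - c‖)]
      _ ≤ _ := by gcongr
  have h2 : (P + P') ^ 2 ≤ 8 * f * W := by nlinarith [sq_nonneg (P - P')]
  -- With `u = P + P'` and `v` the weighted sum, the square gives `(u + 2v)² ≤ 4/3 u² + 16 v²`, and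
  -- `u² ≤ 8 f W` produces `32/3`.
  nlinarith [sq_nonneg ((P + P') - 6 * (b * ‖x i - c‖ + b' * ‖x j - c‖))]

/-- Nearest neighbor averaging contracts the spread of the correct vectors. -/
theorem nna_spread_le (hn : 1 ≤ n) (hf : 11 * f ≤ n) (hS : S.card + f = n)
    (hR : ∀ i ∈ S, i ∉ R i ∧ (R i).card = n - f - 1)
    (h : ∀ i ∈ S, IsNNA n f (x i) x (R i) (y i)) :
    spread S y ≤ alpha n f * spread S x := by
  have hSne : S.Nonempty := by rw [← Finset.card_pos]; omega
  have hn' : (1 : ℝ) ≤ n := by exact_mod_cast hn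
  have hf' : (11 : ℝ) * f ≤ n := by exact_mod_cast hf
  have hS' : (S.card : ℝ) = n - f := by
    have := congrArg (Nat.cast (R := ℝ)) hS
    push_cast at this
    linarith
  have key : ∑ j ∈ S, ∑ i ∈ S, ((n : ℝ) - 2 * f) ^ 2 * ‖y i - y j‖ ^ 2
      ≤ ∑ j ∈ S, ∑ i ∈ S, (32 / 3 * f * ∑ k ∈ S, ‖x k - mean S x‖ ^ 2
        + 16 * f ^ 2 * (‖x i - mean S x‖ ^ 2 + ‖x j - mean S x‖ ^ 2)) :=
    Finset.sum_le_sum fun j hj => Finset.sum_le_sum fun i hi =>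
      nna_dist_sq_le hn hf hS hR h _ hi hj
  simp only [← Finset.mul_sum, Finset.sum_add_distrib, Finset.sum_const, nsmul_eq_mul] at key
  rw [sum_sum_norm_sub_sq hSne, ← card_mul_spread hSne] at key
  set h := (S.card : ℝ)
  have hh : 0 < h := by rw [hS']; linarith [Nat.cast_nonneg (α := ℝ) f]
  have hf0 : (0 : ℝ) ≤ f := Nat.cast_nonneg f
  have hx := spread_nonneg S x
  have hfh : 10 * (f : ℝ) ≤ h := by rw [hS']; linarith
  have hn2 : (n : ℝ) - 2 * f = h - f := by rw [hS']; ring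
  rw [hn2] at key
  have key2 : (h - f) ^ 2 * spread S y ≤ (16 / 3 * h + 16 * f) * f * spread S x := by
    have : 0 < 2 * h * h := by positivity
    refine le_of_mul_le_mul_left ?_ this
    linarith
  have hpos : 0 < (h - f) ^ 2 := by
    have : 0 < h - f := by linarith
    positivity
  rw [alpha, ← hS', div_mul_eq_mul_div, le_div_iff₀ hh]
  refine le_of_mul_le_mul_left ?_ hpos
  -- From `10 f ≤ h`: the left side is below `6.94 h²` and the right side above `8 h²`.
  have h1 : (16 / 3 * h + 16 * f) * h ≤ 9.88 * (h - f) ^ 2 := by nlinarith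
  have h2 := mul_le_mul_of_nonneg_right h1 (mul_nonneg hf0 hx)
  have h3 := mul_le_mul_of_nonneg_right key2 hh.le
  linarith

/-- Nearest neighbor averaging nearly preserves the average of the correct vectors. -/
theorem nna_mean_sq_le (hn : 1 ≤ n) (hf : 11 * f ≤ n) (hS : S.card + f = n)
    (hR : ∀ i ∈ S, i ∉ R i ∧ (R i).card = n - f - 1)
    (h : ∀ i ∈ S, IsNNA n f (x i) x (R i) (y i)) :
    ‖mean S y - mean S x‖ ^ 2 ≤ 13 * (f / ((n : ℝ) - f)) * spread S x := by
  have hSne : S.Nonempty := by rw [← Finset.card_pos]; omega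
  have hn' : (1 : ℝ) ≤ n := by exact_mod_cast hn
  have hf' : (11 : ℝ) * f ≤ n := by exact_mod_cast hf
  have hS' : (S.card : ℝ) = n - f := by
    have := congrArg (Nat.cast (R := ℝ)) hS
    push_cast at this
    linarith
  set c := mean S x
  have key : ∀ i ∈ S, ((n : ℝ) - 2 * f) ^ 2 * ‖y i - c‖ ^ 2
      ≤ 9 * f * ∑ k ∈ S, ‖x k - c‖ ^ 2 + 12 * f ^ 2 * ‖x i - c‖ ^ 2 := by
    intro i hi
    obtain ⟨K, hK, hy, hsub⟩ := (h i hi).exists_kept hn hf hS hi (hR i hi).1 (hR i hi).2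
    obtain ⟨A, hA, hAc, hle⟩ := hsub c (K \ S) Finset.sdiff_subset
    have hKS : (K \ S).card ≤ f := card_le_of_disjoint hS Finset.sdiff_disjoint
    -- Here `K`, of size `n - 2f`, plays the role of the correct set in `card_le_of_disjoint`: its
    -- complement has `2f` elements.
    have hSK : (S \ K).card ≤ 2 * f := by
      have := card_le_of_disjoint (f := 2 * f) (S := K) (A := S \ K) (by omega)
        Finset.sdiff_disjoint
      exact this
    have hP := sq_sum_norm_le (a := f) hA (by rw [hAc]; exact_mod_cast hKS) x c
    have hP' := sq_sum_norm_le (a := 2 * f) (Finset.sdiff_subset (s := S) (t := K))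
      (by exact_mod_cast hSK) x c
    have hb : (((K \ S) \ S).card : ℝ) ≤ f := by
      exact_mod_cast (Finset.card_le_card Finset.sdiff_subset).trans hKS
    -- The deviations of the correct vectors from their mean `c` sum to zero, so the sum over `K`
    -- can be compared with the sum over all of `S` for free.
    have hdiff : ((n : ℝ) - 2 * f) • (y i - c)
        = ∑ k ∈ K \ S, (x k - c) - ∑ k ∈ S \ K, (x k - c) := by
      rw [Finset.sum_sdiff_sub_sum_sdiff, sum_sub_mean hSne, Finset.sum_sub_distrib,
        Finset.sum_const, hK, smul_sub, hy, sub_zero, ← Nat.cast_smul_eq_nsmul ℝ,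
        Nat.cast_sub (by omega)]
      push_cast; rfl
    set W := ∑ k ∈ S, ‖x k - c‖ ^ 2
    set b : ℝ := (((K \ S) \ S).card : ℝ)
    set P := ∑ k ∈ A, ‖x k - c‖
    set P' := ∑ k ∈ S \ K, ‖x k - c‖
    have hnorm : |(n : ℝ) - 2 * f| * ‖y i - c‖ ≤ P + P' + 2 * (f * ‖x i - c‖) := by
      rw [← Real.norm_eq_abs, ← norm_smul, hdiff]
      have h1 := norm_sub_le (∑ k ∈ K \ S, (x k - c)) (∑ k ∈ S \ K, (x k - c))
      have h2 := norm_sum_le (K \ S) (fun k => x k - c)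
      have h3 := norm_sum_le (S \ K) (fun k => x k - c)
      have h4 := mul_le_mul_of_nonneg_right hb (norm_nonneg (x i - c))
      linarith
    have hsq : ((n : ℝ) - 2 * f) ^ 2 * ‖y i - c‖ ^ 2
        ≤ (P + P' + 2 * (f * ‖x i - c‖)) ^ 2 := by
      rw [← sq_abs ((n : ℝ) - 2 * f), ← mul_pow]
      gcongr
    nlinarith [sq_nonneg (P - P'), sq_nonneg (P - 2 * (f * ‖x i - c‖)),
      sq_nonneg (P' - 2 * (f * ‖x i - c‖))]
  have key2 := Finset.sum_le_sum key
  simp only [← Finset.mul_sum, Finset.sum_add_distrib, Finset.sum_const, nsmul_eq_mul] at key2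
  rw [← card_mul_spread hSne] at key2
  have hmean := norm_mean_sub_sq_le hSne y c
  set h := (S.card : ℝ)
  have hh : 0 < h := by rw [hS']; linarith [Nat.cast_nonneg (α := ℝ) f]
  have hf0 : (0 : ℝ) ≤ f := Nat.cast_nonneg f
  have hx := spread_nonneg S x
  have hfh : 10 * (f : ℝ) ≤ h := by rw [hS']; linarith
  have hn2 : (n : ℝ) - 2 * f = h - f := by rw [hS']; ring
  rw [hn2] at key2
  rw [inv_mul_eq_div, le_div_iff₀ hh] at hmean
  have hpos : 0 < (h - f) ^ 2 := by
    have : 0 < h - f := by linarith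
    positivity
  -- Again `10 f ≤ h`: at most `10.2 h²` against at least `10.53 h²`.
  have h1 : (9 * h + 12 * f) * h ≤ 13 * (h - f) ^ 2 := by nlinarith
  have h2 : (h - f) ^ 2 * ‖mean S y - c‖ ^ 2 ≤ (9 * h + 12 * f) * (f * spread S x) := by
    refine le_of_mul_le_mul_left ?_ hh
    linarith [mul_le_mul_of_nonneg_left hmean hpos.le]
  rw [← hS', mul_div_assoc', div_mul_eq_mul_div, le_div_iff₀ hh]
  refine le_of_mul_le_mul_left ?_ hpos
  linarith [mul_le_mul_of_nonneg_right h1 (mul_nonneg hf0 hx), mul_le_mul_of_nonneg_right h2 hh.le]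

end NearestNeighborAveraging

/-! ### Descent inequalities for smooth functions. -/

section Smoothness

variable {F : Type*} [NormedAddCommGroup F] [InnerProductSpace ℝ F] [CompleteSpace F]
  {Q : F → ℝ} {L : ℝ}

/-- The quadratic upper bound for functions with a Lipschitz gradient. -/
theorem le_quadratic_of_lipschitz_gradient (hQ : Differentiable ℝ Q)
    (hL : ∀ x y, ‖gradient Q x - gradient Q y‖ ≤ L * ‖x - y‖) (x y : F) :
    Q y ≤ Q x + inner ℝ (gradient Q x) (y - x) + L / 2 * ‖y - x‖ ^ 2 := by
  set v := y - x
  have hd : ∀ s : ℝ, HasDerivAt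
      (fun s : ℝ => Q (x + s • v) - s * inner ℝ (gradient Q x) v - L / 2 * s ^ 2 * ‖v‖ ^ 2)
      (inner ℝ (gradient Q (x + s • v)) v - 1 * inner ℝ (gradient Q x) v
        - L / 2 * (2 * s) * ‖v‖ ^ 2) s := fun s => by
    have h1 : HasDerivAt (fun s : ℝ => x + s • v) v s := by
      simpa using ((hasDerivAt_id s).smul_const v).const_add x
    have h2 := (hQ (x + s • v)).hasFDerivAt.comp_hasDerivAt s h1
    rw [← inner_gradient_left] at h2
    refine (h2.sub ((hasDerivAt_id s).mul_const _)).sub ?_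
    simpa using ((hasDerivAt_pow 2 s).const_mul (L / 2)).mul_const (‖v‖ ^ 2)
  have hanti := antitoneOn_of_deriv_nonpos (convex_Icc (0 : ℝ) 1)
    (fun s _ => (hd s).continuousAt.continuousWithinAt)
    (fun s _ => (hd s).differentiableAt.differentiableWithinAt) (fun s hs => by
      rw [interior_Icc] at hs
      rw [(hd s).deriv, one_mul, ← inner_sub_left]
      have h1 := real_inner_le_norm (gradient Q (x + s • v) - gradient Q x) v
      have h2 := hL (x + s • v) x
      rw [add_sub_cancel_left, norm_smul, Real.norm_of_nonneg hs.1.le] at h2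
      nlinarith [norm_nonneg v])
  have := hanti (Set.left_mem_Icc.2 zero_le_one) (Set.right_mem_Icc.2 zero_le_one) zero_le_one
  simp only [one_smul, zero_smul, add_zero] at this
  have hv : x + v = y := by simp [v]
  rw [hv] at this
  linarith

/-- A gradient step of size `1/L` gains at least `‖∇Q‖²/(2L)`, and the value cannot fall below the
infimum. This bounds the initial momentum lag, and shows that a point of zero gap is stationary. -/
theorem sq_norm_gradient_le (hQ : Differentiable ℝ Q) (hL0 : 0 < L)
    (hL : ∀ x y, ‖gradient Q x - gradient Q y‖ ≤ L * ‖x - y‖) (hb : BddBelow (Set.range Q))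
    (x : F) : ‖gradient Q x‖ ^ 2 ≤ 2 * L * (Q x - ⨅ y, Q y) := by
  have h1 := le_quadratic_of_lipschitz_gradient hQ hL x (x - L⁻¹ • gradient Q x)
  have h2 := ciInf_le hb (x - L⁻¹ • gradient Q x)
  rw [sub_sub_cancel_left, inner_neg_right, norm_neg, inner_smul_right, norm_smul,
    real_inner_self_eq_norm_sq, norm_inv, Real.norm_of_nonneg hL0.le] at h1
  have h3 : L / 2 * (L⁻¹ * ‖gradient Q x‖) ^ 2 = L⁻¹ * ‖gradient Q x‖ ^ 2 / 2 := by
    field_simp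
  have h4 : L⁻¹ * ‖gradient Q x‖ ^ 2 / 2 ≤ Q x - ⨅ y, Q y := by linarith
  have h5 : 2 * L * (L⁻¹ * ‖gradient Q x‖ ^ 2 / 2) = ‖gradient Q x‖ ^ 2 := by
    field_simp
  have := mul_le_mul_of_nonneg_left h4 (show 0 ≤ 2 * L by linarith)
  linarith

/-- Decrease of a smooth function along a step `-γ d`. -/
theorem step_decrease (hQ : Differentiable ℝ Q)
    (hL : ∀ x y, ‖gradient Q x - gradient Q y‖ ≤ L * ‖x - y‖) {x y d : F} {γ : ℝ}
    (hy : y = x - γ • d) :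
    γ / 2 * (‖gradient Q x‖ ^ 2 + (1 - L * γ) * ‖d‖ ^ 2 - ‖d - gradient Q x‖ ^ 2) ≤ Q x - Q y := by
  have h1 := le_quadratic_of_lipschitz_gradient hQ hL x y
  have h2 : y - x = -(γ • d) := by rw [hy]; abel
  rw [h2, inner_neg_right, inner_smul_right, norm_neg, norm_smul, mul_pow, Real.norm_eq_abs,
    sq_abs] at h1
  have h3 := norm_sub_sq_real d (gradient Q x)
  rw [real_inner_comm] at h3
  rw [h3]
  linarith

end Smoothness

/-! ### Deterministic analysis along one sample path. -/

section Trajectories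

variable {ι F : Type*} [NormedAddCommGroup F] [InnerProductSpace ℝ F]

/-- A family of models `θ t i` that follow momentum gradient steps with gradients
`G i (θ t i) + ξ t i`, each followed by an averaging that contracts the spread by the factor `α` and
moves the mean by at most `lam` times the spread. -/
structure Trajectory (S : Finset ι) (G : ι → F → F) (L ζ β γ α lam : ℝ) (T : ℕ)
    (θ₀ : F) (θ ξ : ℕ → ι → F) : Prop where
  nonempty : S.Nonempty
  L_pos : 0 < L
  γ_pos : 0 < γ
  γ_le : 12 * γ * L ≤ 1
  β_nonneg : 0 ≤ β
  β_le : 6 * γ * L ≤ 1 - β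
  α_nonneg : 0 ≤ α
  α_lt : α < 1
  lam_nonneg : 0 ≤ lam
  small : 4 * L ^ 2 * (2 * α * (1 + α) / (1 - α) ^ 2) * γ ^ 2 ≤ 1 / 2
  lipschitz : ∀ i ∈ S, ∀ x y, ‖G i x - G i y‖ ≤ L * ‖x - y‖
  hetero : ∀ x, spread S (fun i => G i x) ≤ ζ ^ 2
  init : ∀ i ∈ S, θ 0 i = θ₀
  contract : ∀ t < T, spread S (θ (t + 1)) ≤ α * spread S (fun i => θ t i
    - γ • ema β (fun s => G i (θ s i) + ξ s i) (t + 1))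
  drift : ∀ t < T, ‖mean S (θ (t + 1)) - mean S (fun i => θ t i
    - γ • ema β (fun s => G i (θ s i) + ξ s i) (t + 1))‖ ^ 2 ≤ lam * spread S (fun i => θ t i
    - γ • ema β (fun s => G i (θ s i) + ξ s i) (t + 1))

namespace Trajectory

variable {S : Finset ι} {G : ι → F → F} {L ζ β γ α lam : ℝ} {T : ℕ} {θ₀ : F} {θ ξ : ℕ → ι → F}

/-- The accumulated noise and heterogeneity. -/
noncomputable def noiseSum (S : Finset ι) (ζ β : ℝ) (T : ℕ) (ξ : ℕ → ι → F) : ℝ :=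
  ∑ t ∈ Finset.range T, (S.card : ℝ)⁻¹ * ∑ i ∈ S, ‖ema β (fun s => ξ s i) (t + 1)‖ ^ 2
    + 2 * T * ζ ^ 2

theorem β_lt (h : Trajectory S G L ζ β γ α lam T θ₀ θ ξ) : β < 1 := by
  have := mul_pos (mul_pos (show (0 : ℝ) < 6 by norm_num) h.γ_pos) h.L_pos
  linarith [h.β_le]

theorem noiseSum_nonneg : 0 ≤ noiseSum S ζ β T ξ :=
  add_nonneg (Finset.sum_nonneg fun _ _ => mul_nonneg (by positivity)
    (Finset.sum_nonneg fun _ _ => by positivity)) (by positivity)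

theorem spread_zero (h : Trajectory S G L ζ β γ α lam T θ₀ θ ξ) : spread S (θ 0) = 0 := by
  rw [spread_congr h.init]
  simp [spread, mean_const h.nonempty]

/-- All nodes start at the same point, so spread is created only by the momenta, with a factor `γ²`,
and decays geometrically at rate `(1 + α) / 2`. -/
theorem sum_spread_le_sum_spread_momentum (h : Trajectory S G L ζ β γ α lam T θ₀ θ ξ) :
    ∑ t ∈ Finset.range T, spread S (θ t) ≤ 2 * α * (1 + α) / (1 - α) ^ 2 * γ ^ 2
      * ∑ t ∈ Finset.range T,
        spread S (fun i => ema β (fun s => G i (θ s i) + ξ s i) (t + 1)) := by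
  have hα : 0 < 1 - α := sub_pos.2 h.α_lt
  have := sum_le_of_recursion (T := T) (ρ := (1 + α) / 2) (u := fun t => spread S (θ t))
    (v := fun t => α * (1 + α) / (1 - α) * γ ^ 2
      * spread S (fun i => ema β (fun s => G i (θ s i) + ξ s i) (t + 1)))
    (fun t ht => (h.contract t ht).trans (mul_spread_sub_smul_le h.α_nonneg h.α_lt γ S _ _))
  rw [h.spread_zero, zero_add, ← Finset.mul_sum] at this
  have h2 := spread_nonneg S (θ T)
  refine le_of_mul_le_mul_left ?_ (half_pos hα)
  refine le_trans (by linarith) (this.trans_eq ?_)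
  field_simp

/-- Gradients differ because the models differ (smoothness) and because the local losses differ
(heterogeneity at the mean model). -/
theorem sum_sq_dist_gradient_le (h : Trajectory S G L ζ β γ α lam T θ₀ θ ξ) (t : ℕ) :
    spread S (fun i => G i (θ t i)) ≤ 2 * L ^ 2 * spread S (θ t) + 2 * ζ ^ 2 := by
  have hcard : (0 : ℝ) < S.card := by exact_mod_cast h.nonempty.card_pos
  set x := mean S (θ t)
  refine (spread_le h.nonempty _ (mean S (fun i => G i x))).trans ?_
  have h1 : ∑ i ∈ S, ‖G i (θ t i) - mean S (fun i => G i x)‖ ^ 2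
      ≤ ∑ i ∈ S, (2 * L ^ 2 * ‖θ t i - x‖ ^ 2 + 2 * ‖G i x - mean S (fun i => G i x)‖ ^ 2) :=
    Finset.sum_le_sum fun i hi => by
      have h2 := norm_add_sq_le_two (G i (θ t i) - G i x) (G i x - mean S (fun i => G i x))
      rw [sub_add_sub_cancel] at h2
      have h3 : ‖G i (θ t i) - G i x‖ ^ 2 ≤ (L * ‖θ t i - x‖) ^ 2 := by
        gcongr; exact h.lipschitz i hi _ _
      rw [mul_pow] at h3
      linarith
  rw [Finset.sum_add_distrib, ← Finset.mul_sum, ← Finset.mul_sum] at h1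
  have h4 := mul_le_mul_of_nonneg_left h1 (inv_nonneg.2 hcard.le)
  have h5 := h.hetero x
  simp only [spread] at h5 ⊢
  linarith

theorem sum_spread_momentum_le (h : Trajectory S G L ζ β γ α lam T θ₀ θ ξ) :
    ∑ t ∈ Finset.range T, spread S (fun i => ema β (fun s => G i (θ s i) + ξ s i) (t + 1))
      ≤ 4 * L ^ 2 * ∑ t ∈ Finset.range T, spread S (θ t) + 2 * noiseSum S ζ β T ξ := by
  have h1 : ∀ t ∈ Finset.range T,
      spread S (fun i => ema β (fun s => G i (θ s i) + ξ s i) (t + 1))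
      ≤ 2 * spread S (fun i => ema β (fun s => G i (θ s i)) (t + 1))
        + 2 * ((S.card : ℝ)⁻¹ * ∑ i ∈ S, ‖ema β (fun s => ξ s i) (t + 1)‖ ^ 2) := fun t _ => by
    simp only [ema_add]
    refine (spread_add_le S _ _).trans ?_
    have := spread_le h.nonempty (fun i => ema β (fun s => ξ s i) (t + 1)) 0
    simp only [sub_zero] at this
    linarith
  have h2 := Finset.sum_le_sum h1
  rw [Finset.sum_add_distrib, ← Finset.mul_sum, ← Finset.mul_sum] at h2
  have h3 := sum_spread_ema_le h.β_nonneg h.β_lt S (fun t i => G i (θ t i)) T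
  have h4 := Finset.sum_le_sum (s := Finset.range T) fun t _ => h.sum_sq_dist_gradient_le t
  rw [Finset.sum_add_distrib, ← Finset.mul_sum, Finset.sum_const, Finset.card_range,
    nsmul_eq_mul] at h4
  rw [noiseSum]
  linarith

/-- Closes the loop between models and momenta: by `small` the feedback is at most half of the left
side and is absorbed. -/
theorem sum_spread_momentum_le_noise (h : Trajectory S G L ζ β γ α lam T θ₀ θ ξ) :
    ∑ t ∈ Finset.range T, spread S (fun i => ema β (fun s => G i (θ s i) + ξ s i) (t + 1))
      ≤ 4 * noiseSum S ζ β T ξ := by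
  have h1 := h.sum_spread_momentum_le
  have h2 := mul_le_mul_of_nonneg_left h.sum_spread_le_sum_spread_momentum
    (show 0 ≤ 4 * L ^ 2 by positivity)
  have h0 : 0 ≤ ∑ t ∈ Finset.range T,
      spread S (fun i => ema β (fun s => G i (θ s i) + ξ s i) (t + 1)) :=
    Finset.sum_nonneg fun _ _ => spread_nonneg _ _
  have h3 := mul_le_mul_of_nonneg_right h.small h0
  linarith

theorem coeff_nonneg (h : Trajectory S G L ζ β γ α lam T θ₀ θ ξ) :
    0 ≤ 2 * α * (1 + α) / (1 - α) ^ 2 := by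
  have := h.α_nonneg
  positivity

theorem sum_spread_le_noise (h : Trajectory S G L ζ β γ α lam T θ₀ θ ξ) :
    ∑ t ∈ Finset.range T, spread S (θ t)
      ≤ 4 * (2 * α * (1 + α) / (1 - α) ^ 2) * γ ^ 2 * noiseSum S ζ β T ξ := by
  have h1 := h.sum_spread_le_sum_spread_momentum
  have h2 := mul_le_mul_of_nonneg_left h.sum_spread_momentum_le_noise
    (mul_nonneg h.coeff_nonneg (sq_nonneg γ))
  linarith

theorem sum_sq_drift_le (h : Trajectory S G L ζ β γ α lam T θ₀ θ ξ) :
    ∑ t ∈ Finset.range T, ‖mean S (θ (t + 1)) - mean S (fun i => θ t i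
        - γ • ema β (fun s => G i (θ s i) + ξ s i) (t + 1))‖ ^ 2
      ≤ γ ^ 2 * (8 * lam * (2 * α * (1 + α) / (1 - α) ^ 2 + 1) * noiseSum S ζ β T ξ) := by
  have h1 : ∀ t ∈ Finset.range T, ‖mean S (θ (t + 1)) - mean S (fun i => θ t i
        - γ • ema β (fun s => G i (θ s i) + ξ s i) (t + 1))‖ ^ 2
      ≤ 2 * lam * spread S (θ t) + 2 * lam * γ ^ 2
        * spread S (fun i => ema β (fun s => G i (θ s i) + ξ s i) (t + 1)) := fun t ht => by
    refine (h.drift t (Finset.mem_range.1 ht)).trans ?_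
    have := spread_comb_le (c := 1) (p := 1) (q := -γ) (a := 2) (b := 2 * γ ^ 2) S (θ t)
      (fun i => ema β (fun s => G i (θ s i) + ξ s i) (t + 1)) (fun u v => by
        have := norm_add_sq_le_two ((1 : ℝ) • u) ((-γ) • v)
        rw [one_smul, norm_smul (-γ), mul_pow, Real.norm_eq_abs, sq_abs] at this
        rw [one_smul]
        linarith)
    simp only [one_smul, neg_smul, ← sub_eq_add_neg, one_mul] at this
    have := mul_le_mul_of_nonneg_left this h.lam_nonneg
    linarith
  have h2 := Finset.sum_le_sum h1
  rw [Finset.sum_add_distrib, ← Finset.mul_sum, ← Finset.mul_sum] at h2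
  have h3 := mul_le_mul_of_nonneg_left h.sum_spread_le_noise
    (mul_nonneg zero_le_two h.lam_nonneg)
  have h4 := mul_le_mul_of_nonneg_left h.sum_spread_momentum_le_noise
    (mul_nonneg (mul_nonneg zero_le_two h.lam_nonneg) (sq_nonneg γ))
  linarith

variable [CompleteSpace F] {Q : F → ℝ}

theorem lipschitz_gradient (h : Trajectory S G L ζ β γ α lam T θ₀ θ ξ)
    (hG : ∀ x, gradient Q x = mean S (fun i => G i x)) (x y : F) :
    ‖gradient Q x - gradient Q y‖ ≤ L * ‖x - y‖ := by
  have hcard : (0 : ℝ) < S.card := by exact_mod_cast h.nonempty.card_pos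
  rw [hG, hG, ← mean_sub, mean, norm_smul, norm_inv, Real.norm_of_nonneg hcard.le,
    inv_mul_le_iff₀ hcard]
  refine (norm_sum_le_of_le S fun i hi => h.lipschitz i hi x y).trans_eq ?_
  simp

/-- Bias from evaluating the local gradients at different models rather than at their mean. -/
theorem sq_norm_mean_gradient_sub_le (h : Trajectory S G L ζ β γ α lam T θ₀ θ ξ)
    (hG : ∀ x, gradient Q x = mean S (fun i => G i x)) (t : ℕ) :
    ‖mean S (fun i => G i (θ t i)) - gradient Q (mean S (θ t))‖ ^ 2
      ≤ L ^ 2 * spread S (θ t) := by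
  have hcard : (0 : ℝ) < S.card := by exact_mod_cast h.nonempty.card_pos
  rw [hG, ← mean_sub]
  have h1 := norm_mean_sub_sq_le h.nonempty
    (fun i => G i (θ t i) - G i (mean S (θ t))) 0
  simp only [sub_zero] at h1
  refine h1.trans ?_
  rw [spread, mul_left_comm, Finset.mul_sum (a := L ^ 2)]
  refine mul_le_mul_of_nonneg_left (Finset.sum_le_sum fun i hi => ?_) (inv_nonneg.2 hcard.le)
  rw [← mul_pow]
  gcongr
  exact h.lipschitz i hi _ _

/-- The lag of the noise-free momentum behind the gradient contracts by `β` per step and is fed by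
the bias `b` and by the motion of the gradient, at most `Lγ‖d‖`. Leaving the noise out keeps the
estimate pathwise and lets the noise be averaged over the nodes separately. -/
theorem sum_sq_momentum_error_le (h : Trajectory S G L ζ β γ α lam T θ₀ θ ξ)
    (hG : ∀ x, gradient Q x = mean S (fun i => G i x)) :
    ∑ t ∈ Finset.range T, ‖ema β (fun s => mean S (fun i => G i (θ s i))) (t + 1)
        - gradient Q (mean S (θ t))‖ ^ 2
      ≤ ‖gradient Q θ₀‖ ^ 2 / (6 * γ * L) + 3 * L ^ 2 * ∑ t ∈ Finset.range T, spread S (θ t)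
        + 1 / 18 * ∑ t ∈ Finset.range T, ‖γ⁻¹ • (mean S (θ t) - mean S (θ (t + 1)))‖ ^ 2 := by
  set g : ℕ → F := fun t => gradient Q (mean S (θ t)) with hg
  set a : ℕ → F := ema β (fun s => mean S (fun i => G i (θ s i))) with ha
  set b : ℕ → F := fun t => mean S (fun i => G i (θ t i)) - g t with hb
  set d : ℕ → F := fun t => γ⁻¹ • (mean S (θ t) - mean S (θ (t + 1))) with hd
  have hβ : 0 < 1 - β := sub_pos.2 h.β_lt
  have hγL : 0 < γ * L := mul_pos h.γ_pos h.L_pos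
  have hrec : ∀ t < T, ‖a (t + 1) - g (t + 1)‖ ^ 2 ≤ β * ‖a t - g t‖ ^ 2
      + (2 * (1 - β) * ‖b t‖ ^ 2 + γ * L / 3 * ‖d t‖ ^ 2) := fun t _ => by
    -- Writing the motion of the gradient as `1 - β` times its rescaling makes this a convex
    -- combination. After squaring, the motion costs `2(Lγ‖d‖)²/(1-β)`, which is at most `γL/3 ‖d‖²`
    -- since `1 - β ≥ 6γL`.
    have e : a (t + 1) - g (t + 1) = β • (a t - g t)
        + (1 - β) • (b t + (1 - β)⁻¹ • (g t - g (t + 1))) := by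
      rw [smul_add, smul_inv_smul₀ hβ.ne', ha, ema, hb]
      module
    have h1 := norm_convexComb_sq_le h.β_nonneg h.β_lt.le (a t - g t)
      (b t + (1 - β)⁻¹ • (g t - g (t + 1)))
    rw [← e] at h1
    have h2 := norm_add_sq_le_two (b t) ((1 - β)⁻¹ • (g t - g (t + 1)))
    have h3 : ‖g t - g (t + 1)‖ ≤ L * (γ * ‖d t‖) := by
      refine (h.lipschitz_gradient hG _ _).trans_eq ?_
      rw [hd, norm_smul, norm_inv, Real.norm_of_nonneg h.γ_pos.le,
        mul_inv_cancel_left₀ h.γ_pos.ne']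
    have h4 : (1 - β) * (2 * ‖(1 - β)⁻¹ • (g t - g (t + 1))‖ ^ 2) ≤ γ * L / 3 * ‖d t‖ ^ 2 := by
      rw [norm_smul, norm_inv, Real.norm_of_nonneg hβ.le, mul_pow]
      have h5 : ‖g t - g (t + 1)‖ ^ 2 ≤ (L * (γ * ‖d t‖)) ^ 2 := by gcongr
      have h6 : (1 - β) * (2 * ((1 - β)⁻¹ ^ 2 * ‖g t - g (t + 1)‖ ^ 2))
          = 2 * ‖g t - g (t + 1)‖ ^ 2 / (1 - β) := by field_simp
      rw [h6, div_le_iff₀ hβ]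
      have h7 := mul_le_mul_of_nonneg_left h.β_le
        (show 0 ≤ γ * L / 3 * ‖d t‖ ^ 2 by positivity)
      nlinarith
    have h8 := mul_le_mul_of_nonneg_left h2 hβ.le
    linarith
  have hsum := sum_le_of_recursion (u := fun t => ‖a t - g t‖ ^ 2) hrec
  rw [Finset.sum_add_distrib, ← Finset.mul_sum, ← Finset.mul_sum] at hsum
  -- The average starts at zero, so the initial lag is the full initial gradient.
  have h0 : ‖a 0 - g 0‖ ^ 2 = ‖gradient Q θ₀‖ ^ 2 := by
    have : mean S (θ 0) = θ₀ := by rw [mean_congr h.init, mean_const h.nonempty]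
    simp only [ha, hg, ema, zero_sub, norm_neg, this]
  simp only [h0] at hsum
  set D := ∑ t ∈ Finset.range T, ‖d t‖ ^ 2
  set B := ∑ t ∈ Finset.range T, ‖b t‖ ^ 2
  have hD : 0 ≤ D := Finset.sum_nonneg fun _ _ => by positivity
  have hr : ∑ t ∈ Finset.range T, ‖a t - g t‖ ^ 2
      ≤ ‖gradient Q θ₀‖ ^ 2 / (6 * γ * L) + 2 * B + 1 / 18 * D := by
    refine le_of_mul_le_mul_left ?_ hβ
    have h1 : 0 ≤ ‖gradient Q θ₀‖ ^ 2 / (6 * γ * L) + 1 / 18 * D := by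
      have := h.γ_pos; have := h.L_pos; positivity
    have h2 := mul_le_mul_of_nonneg_right h.β_le h1
    have h3 : 6 * γ * L * (‖gradient Q θ₀‖ ^ 2 / (6 * γ * L)) = ‖gradient Q θ₀‖ ^ 2 :=
      mul_div_cancel₀ _ (by linarith)
    have h4 : 0 ≤ ‖a T - g T‖ ^ 2 := by positivity
    linarith
  have hB : B ≤ L ^ 2 * ∑ t ∈ Finset.range T, spread S (θ t) := by
    rw [Finset.mul_sum]
    exact Finset.sum_le_sum fun t _ => h.sq_norm_mean_gradient_sub_le hG t
  -- The step at `t` uses the average at `t + 1`, which must be compared with the gradient at `t`;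
  -- this costs one more `B`.
  have hfin : ∑ t ∈ Finset.range T, ‖a (t + 1) - g t‖ ^ 2
      ≤ ∑ t ∈ Finset.range T, ‖a t - g t‖ ^ 2 + B := by
    rw [← Finset.sum_add_distrib]
    refine Finset.sum_le_sum fun t _ => ?_
    have e : a (t + 1) - g t = β • (a t - g t) + (1 - β) • b t := by
      rw [ha, ema, hb]
      module
    rw [e]
    refine (norm_convexComb_sq_le h.β_nonneg h.β_lt.le _ _).trans ?_
    have h1 := mul_le_mul_of_nonneg_right h.β_lt.le (sq_nonneg ‖a t - g t‖)
    have h2 := mul_nonneg h.β_nonneg (sq_nonneg ‖b t‖)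
    linarith
  linarith

/-- Pathwise bound on the gradients at the average models. -/
theorem sum_sq_gradient_mean_le (h : Trajectory S G L ζ β γ α lam T θ₀ θ ξ)
    (hQ : Differentiable ℝ Q) (hG : ∀ x, gradient Q x = mean S (fun i => G i x))
    (hb : BddBelow (Set.range Q)) :
    ∑ t ∈ Finset.range T, ‖gradient Q (mean S (θ t))‖ ^ 2
      ≤ 3 * (Q θ₀ - ⨅ x, Q x) / γ
        + 3 * ∑ t ∈ Finset.range T, ‖mean S (fun i => ema β (fun s => ξ s i) (t + 1))‖ ^ 2
        + (2 * α * (1 + α) / (1 - α) ^ 2 / 4 + 24 * lam * (2 * α * (1 + α) / (1 - α) ^ 2 + 1))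
          * noiseSum S ζ β T ξ := by
  have hLip := h.lipschitz_gradient hG
  have hγ := h.γ_pos
  have hL := h.L_pos
  have hγL : 0 < γ * L := mul_pos hγ hL
  set κ := 2 * α * (1 + α) / (1 - α) ^ 2
  set d : ℕ → F := fun t => γ⁻¹ • (mean S (θ t) - mean S (θ (t + 1))) with hd
  set g : ℕ → F := fun t => gradient Q (mean S (θ t)) with hg
  have hinit : mean S (θ 0) = θ₀ := by rw [mean_congr h.init, mean_const h.nonempty]
  have hdesc : ∑ t ∈ Finset.range T,
      γ / 2 * (‖g t‖ ^ 2 + (1 - L * γ) * ‖d t‖ ^ 2 - ‖d t - g t‖ ^ 2)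
      ≤ Q θ₀ - ⨅ x, Q x := by
    refine (Finset.sum_le_sum fun t _ => step_decrease hQ hLip (x := mean S (θ t))
      (y := mean S (θ (t + 1))) (d := d t) ?_).trans ?_
    · simp only [hd]
      rw [smul_inv_smul₀ hγ.ne']; abel
    · rw [Finset.sum_range_sub' (fun t => Q (mean S (θ t))), hinit]
      linarith [ciInf_le hb (mean S (θ T))]
  rw [← Finset.mul_sum, Finset.sum_sub_distrib, Finset.sum_add_distrib, ← Finset.mul_sum] at hdesc
  -- Three sources of error in the effective direction `d`: momentum lag, averaged noise, and drift
  -- of the mean divided by `γ`.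
  have herr : ∑ t ∈ Finset.range T, ‖d t - g t‖ ^ 2
      ≤ 3 * ∑ t ∈ Finset.range T, ‖ema β (fun s => mean S (fun i => G i (θ s i))) (t + 1)
          - g t‖ ^ 2
        + 3 * ∑ t ∈ Finset.range T, ‖mean S (fun i => ema β (fun s => ξ s i) (t + 1))‖ ^ 2
        + 3 * (γ⁻¹ ^ 2 * ∑ t ∈ Finset.range T,
          ‖mean S (θ (t + 1)) - mean S (fun i => θ t i
            - γ • ema β (fun s => G i (θ s i) + ξ s i) (t + 1))‖ ^ 2) := by
    simp only [Finset.mul_sum, ← Finset.sum_add_distrib]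
    refine Finset.sum_le_sum fun t _ => ?_
    have e : d t - g t = (ema β (fun s => mean S (fun i => G i (θ s i))) (t + 1) - g t)
        + mean S (fun i => ema β (fun s => ξ s i) (t + 1))
        + -(γ⁻¹ • (mean S (θ (t + 1)) - mean S (fun i => θ t i
            - γ • ema β (fun s => G i (θ s i) + ξ s i) (t + 1)))) := by
      simp only [ema_add]
      rw [mean_sub, mean_smul, mean_add, mean_ema S β (fun s i => G i (θ s i)), ← sub_add,
        smul_add γ⁻¹, inv_smul_smul₀ hγ.ne', hd]
      module
    rw [e]
    refine (norm_add_sq_le_three _ _ _).trans_eq ?_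
    rw [norm_neg, norm_smul γ⁻¹, mul_pow, Real.norm_eq_abs, sq_abs]
  have h1 := h.sum_sq_momentum_error_le hG
  have h2 := sq_norm_gradient_le hQ hL hLip hb θ₀
  have h3 : ‖gradient Q θ₀‖ ^ 2 / (6 * γ * L) ≤ (Q θ₀ - ⨅ x, Q x) / γ / 3 := by
    rw [div_div, div_le_div_iff₀ (by linarith) (by linarith)]
    nlinarith
  have h4 := mul_le_mul_of_nonneg_left h.sum_sq_drift_le (sq_nonneg γ⁻¹)
  have h5 : γ⁻¹ ^ 2 * γ ^ 2 = 1 := by rw [← mul_pow, inv_mul_cancel₀ hγ.ne', one_pow]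
  rw [← mul_assoc, h5, one_mul] at h4
  have h6 : L ^ 2 * ∑ t ∈ Finset.range T, spread S (θ t) ≤ κ / 36 * noiseSum S ζ β T ξ := by
    refine (mul_le_mul_of_nonneg_left h.sum_spread_le_noise (sq_nonneg L)).trans ?_
    have h7 : (γ * L) ^ 2 ≤ (1 / 12) ^ 2 := by
      have := h.γ_le
      gcongr
      linarith
    have h8 := mul_le_mul_of_nonneg_right h7 (mul_nonneg h.coeff_nonneg
      (noiseSum_nonneg (S := S) (ζ := ζ) (β := β) (T := T) (ξ := ξ)))
    rw [mul_pow] at h8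
    linarith
  have h9 : ∑ t ∈ Finset.range T, ‖g t‖ ^ 2 + (1 - L * γ) * ∑ t ∈ Finset.range T, ‖d t‖ ^ 2
      - ∑ t ∈ Finset.range T, ‖d t - g t‖ ^ 2 ≤ 2 * ((Q θ₀ - ⨅ x, Q x) / γ) := by
    rw [mul_div_assoc', le_div_iff₀ hγ]
    linarith
  -- The lag contributes `3 · 1/18 = 1/6` of `∑ ‖d‖²`; as `Lγ ≤ 1/12`, the descent term covers it.
  have h10 : 0 ≤ (1 - L * γ - 1 / 6) * ∑ t ∈ Finset.range T, ‖d t‖ ^ 2 := by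
    have := h.γ_le
    exact mul_nonneg (by linarith) (Finset.sum_nonneg fun _ _ => by positivity)
  rw [mul_div_assoc]
  linarith

/-- Pathwise bound on the gradients at the models of one node. -/
theorem sum_sq_gradient_le (h : Trajectory S G L ζ β γ α lam T θ₀ θ ξ)
    (hQ : Differentiable ℝ Q) (hG : ∀ x, gradient Q x = mean S (fun i => G i x))
    (hb : BddBelow (Set.range Q)) {i : ι} (hi : i ∈ S) :
    ∑ t ∈ Finset.range T, ‖gradient Q (θ t i)‖ ^ 2
      ≤ 6 * (Q θ₀ - ⨅ x, Q x) / γ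
        + 6 * ∑ t ∈ Finset.range T, ‖mean S (fun i => ema β (fun s => ξ s i) (t + 1))‖ ^ 2
        + (2 * α * (1 + α) / (1 - α) ^ 2 / 2 + 48 * lam * (2 * α * (1 + α) / (1 - α) ^ 2 + 1)
            + 8 * L ^ 2 * S.card * (2 * α * (1 + α) / (1 - α) ^ 2) * γ ^ 2)
          * noiseSum S ζ β T ξ := by
  have h1 : ∀ t ∈ Finset.range T, ‖gradient Q (θ t i)‖ ^ 2
      ≤ 2 * ‖gradient Q (mean S (θ t))‖ ^ 2 + 2 * L ^ 2 * S.card * spread S (θ t) := fun t _ => by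
    have h2 := norm_add_sq_le_two (gradient Q (mean S (θ t)))
      (gradient Q (θ t i) - gradient Q (mean S (θ t)))
    rw [add_sub_cancel] at h2
    have h3 : ‖gradient Q (θ t i) - gradient Q (mean S (θ t))‖ ^ 2
        ≤ (L * ‖θ t i - mean S (θ t)‖) ^ 2 := by
      gcongr; exact h.lipschitz_gradient hG _ _
    -- A single node may carry the whole spread, hence the factor `S.card`. It is harmless: it comes
    -- with `γ²`, so that the term ends up among the `O(1/T)` ones.
    have h4 := mul_le_mul_of_nonneg_left (norm_sub_mean_sq_le hi (θ t)) (sq_nonneg L)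
    rw [mul_pow] at h3
    linarith
  have h2 := Finset.sum_le_sum h1
  rw [Finset.sum_add_distrib, ← Finset.mul_sum, ← Finset.mul_sum] at h2
  have h3 := h.sum_sq_gradient_mean_le hQ hG hb
  have h4 := mul_le_mul_of_nonneg_left h.sum_spread_le_noise
    (show 0 ≤ 2 * L ^ 2 * (S.card : ℝ) by positivity)
  rw [mul_div_assoc] at h3 ⊢
  linarith

end Trajectory

end Trajectories

/-! ### Exchanging derivative and expectation under an `L²` bound. -/

section DifferentiationUnderTheIntegral

open Filter Topology

/-- Convergence of integrals for a pointwise convergent sequence that is bounded in `L²`. -/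
theorem tendsto_integral_of_lintegral_sq_le {X : Type*} [MeasurableSpace X] {μ : Measure X}
    [IsProbabilityMeasure μ] {A : ℕ → X → ℝ} {a : X → ℝ} (hA : ∀ k, Measurable (A k))
    (ha : Measurable a) {C : ENNReal} (hC : C ≠ ⊤) (hAC : ∀ k, ∫⁻ x, ‖A k x‖ₑ ^ 2 ∂μ ≤ C)
    (haC : ∫⁻ x, ‖a x‖ₑ ^ 2 ∂μ ≤ C) (hlim : ∀ x, Tendsto (fun k => A k x) atTop (𝓝 (a x))) :
    Tendsto (fun k => ∫ x, A k x ∂μ) atTop (𝓝 (∫ x, a x ∂μ)) := by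
  have hint : ∀ b : X → ℝ, Measurable b → ∫⁻ x, ‖b x‖ₑ ^ 2 ∂μ ≤ C → Integrable b μ := by
    intro b hb hbC
    refine MemLp.integrable (q := 2) (by norm_num) ⟨hb.aestronglyMeasurable, ?_⟩
    rw [eLpNorm_lt_top_iff_lintegral_rpow_enorm_lt_top (by norm_num) (by norm_num)]
    simpa using hbC.trans_lt hC.lt_top
  refine tendsto_integral_of_L1 a (hint a ha haC).aestronglyMeasurable
    (Eventually.of_forall fun k => hint _ (hA k) (hAC k)) ?_
  have hsq : ∀ k, ∫⁻ x, ‖A k x - a x‖ₑ ^ 2 ∂μ ≤ 2 * C + 2 * C := fun k => by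
    calc ∫⁻ x, ‖A k x - a x‖ₑ ^ 2 ∂μ
        ≤ ∫⁻ x, (2 * ‖A k x‖ₑ ^ 2 + 2 * ‖a x‖ₑ ^ 2) ∂μ := lintegral_mono fun x => by
          have := norm_add_sq_le_two (A k x) (-a x)
          rw [← sub_eq_add_neg, norm_neg] at this
          have h2 := ENNReal.ofReal_le_ofReal this
          rw [ENNReal.ofReal_add (by positivity) (by positivity),
            ENNReal.ofReal_mul (by positivity), ENNReal.ofReal_mul (by positivity),
            ENNReal.ofReal_pow (by positivity), ENNReal.ofReal_pow (by positivity),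
            ENNReal.ofReal_pow (by positivity)] at h2
          simpa only [ofReal_norm, ENNReal.ofReal_ofNat] using h2
      _ = 2 * ∫⁻ x, ‖A k x‖ₑ ^ 2 ∂μ + 2 * ∫⁻ x, ‖a x‖ₑ ^ 2 ∂μ := by
          rw [lintegral_add_left (by fun_prop), lintegral_const_mul _ (by fun_prop),
            lintegral_const_mul _ (by fun_prop)]
      _ ≤ 2 * C + 2 * C := by gcongr; exact hAC k
  rw [ENNReal.tendsto_nhds_zero]
  intro ε hε
  set D := 2 * C + 2 * C with hD
  have hDtop : D ≠ ⊤ := by finiteness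
  -- Truncation: `|A - a| ≤ min(|A - a|, M) + |A - a|²/M`. Dominated convergence handles the first
  -- part, and the `L²` bound makes the second uniformly small for large `M`.
  obtain ⟨M, hM⟩ : ∃ M : NNReal, M ≠ 0 ∧ (M : ENNReal)⁻¹ * D ≤ ε / 2 := by
    have h1 : Tendsto (fun k : ℕ => ((k : ENNReal))⁻¹ * D) atTop (𝓝 (0 * D)) :=
      ENNReal.Tendsto.mul_const ENNReal.tendsto_inv_nat_nhds_zero (Or.inr hDtop)
    rw [zero_mul] at h1
    obtain ⟨k, hk, hk1⟩ := ((ENNReal.tendsto_nhds_zero.1 h1 (ε / 2)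
      (ENNReal.half_pos hε.ne')).and (eventually_ge_atTop 1)).exists
    exact ⟨k, by exact_mod_cast (by omega : k ≠ 0), by simpa using hk⟩
  have hM0 : (M : ENNReal) ≠ 0 := by exact_mod_cast hM.1
  have hmin : Tendsto (fun k => ∫⁻ x, min ‖A k x - a x‖ₑ M ∂μ) atTop (𝓝 (∫⁻ _, 0 ∂μ)) := by
    refine tendsto_lintegral_of_dominated_convergence (fun _ => (M : ENNReal))
      (fun k => by have := hA k; fun_prop) (fun k => ae_of_all _ fun x => min_le_right _ _)
      (by simp) (ae_of_all _ fun x => ?_)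
    have h1 : Tendsto (fun k => ‖A k x - a x‖ₑ) atTop (𝓝 ‖a x - a x‖ₑ) :=
      ((hlim x).sub_const (a x)).enorm
    simpa using h1.min (tendsto_const_nhds (x := (M : ENNReal)))
  rw [lintegral_zero] at hmin
  filter_upwards [ENNReal.tendsto_nhds_zero.1 hmin (ε / 2) (ENNReal.half_pos hε.ne')] with k hk
  calc ∫⁻ x, ‖A k x - a x‖ₑ ∂μ
      ≤ ∫⁻ x, (min ‖A k x - a x‖ₑ M + (M : ENNReal)⁻¹ * ‖A k x - a x‖ₑ ^ 2) ∂μ :=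
        lintegral_mono fun x => by
          rcases le_total ‖A k x - a x‖ₑ M with h | h
          · rw [min_eq_left h]; exact le_self_add
          · refine le_add_left ?_
            calc ‖A k x - a x‖ₑ = (M : ENNReal)⁻¹ * (M * ‖A k x - a x‖ₑ) := by
                  rw [← mul_assoc, ENNReal.inv_mul_cancel hM0 ENNReal.coe_ne_top, one_mul]
              _ ≤ _ := by rw [sq]; gcongr
    _ = ∫⁻ x, min ‖A k x - a x‖ₑ M ∂μ + (M : ENNReal)⁻¹ * ∫⁻ x, ‖A k x - a x‖ₑ ^ 2 ∂μ := by
        have := hA k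
        rw [lintegral_add_left (by fun_prop), lintegral_const_mul _ (by fun_prop)]
    _ ≤ ε / 2 + ε / 2 := by
        gcongr
        exact (mul_le_mul_right (hsq k) _).trans hM.2
    _ = ε := ENNReal.add_halves ε

/-- Fundamental theorem of calculus and Cauchy–Schwarz; if the derivative is not integrable, the
right-hand integral of `‖g'‖ₑ` is infinite and the first step is trivial. -/
theorem enorm_sub_sq_le_lintegral_deriv_sq {g g' : ℝ → ℝ} (hg' : Measurable g')
    (hd : ∀ s, HasDerivAt g (g' s) s) {t : ℝ} (ht : 0 ≤ t) :
    ‖g t - g 0‖ₑ ^ 2 ≤ ENNReal.ofReal t * ∫⁻ s in Set.Ioc 0 t, ‖g' s‖ₑ ^ 2 := by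
  have h1 : ‖g t - g 0‖ₑ ≤ ∫⁻ s in Set.Ioc 0 t, ‖g' s‖ₑ := by
    by_cases hfin : ∫⁻ s in Set.Ioc 0 t, ‖g' s‖ₑ = ⊤
    · rw [hfin]; exact le_top
    · have hint : IntervalIntegrable g' volume 0 t := by
        rw [intervalIntegrable_iff_integrableOn_Ioc_of_le ht]
        exact ⟨hg'.aestronglyMeasurable, lt_top_iff_ne_top.2 hfin⟩
      rw [← intervalIntegral.integral_eq_sub_of_hasDerivAt (fun s _ => hd s) hint,
        intervalIntegral.integral_of_le ht]
      exact enorm_integral_le_lintegral_enorm _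
  have h2 := ENNReal.lintegral_mul_le_Lp_mul_Lq (volume.restrict (Set.Ioc 0 t))
    Real.HolderConjugate.two_two (f := fun _ => 1) (g := fun s => ‖g' s‖ₑ) (by fun_prop)
    (by fun_prop)
  simp only [Pi.mul_apply, one_mul, ENNReal.one_rpow, lintegral_const, MeasurableSet.univ,
    Measure.restrict_apply, Set.univ_inter, Real.volume_Ioc, sub_zero] at h2
  calc ‖g t - g 0‖ₑ ^ 2 ≤ (∫⁻ s in Set.Ioc 0 t, ‖g' s‖ₑ) ^ 2 := by gcongr
    _ ≤ _ := by
      refine (pow_le_pow_left' h2 2).trans_eq ?_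
      rw [mul_pow, ← ENNReal.rpow_mul_natCast, ← ENNReal.rpow_mul_natCast]
      norm_num

/-- Differentiation under the integral, for a family whose derivative is bounded in `L²`. -/
theorem integral_deriv_eq_of_lintegral_sq_le {X : Type*} [MeasurableSpace X] {μ : Measure X}
    [IsProbabilityMeasure μ] {φ ψ : ℝ → X → ℝ} (hφm : ∀ s, Measurable (φ s))
    (hφ : ∀ s, Integrable (φ s) μ) (hψm : Measurable (Function.uncurry ψ))
    (hd : ∀ x s, HasDerivAt (fun s => φ s x) (ψ s x) s) {C : ENNReal} (hC : C ≠ ⊤)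
    (hb : ∀ s ∈ Set.Icc (0 : ℝ) 1, ∫⁻ x, ‖ψ s x‖ₑ ^ 2 ∂μ ≤ C) {m : ℝ}
    (hΦ : HasDerivAt (fun s => ∫ x, φ s x ∂μ) m 0) : ∫ x, ψ 0 x ∂μ = m := by
  set t : ℕ → ℝ := fun k => 1 / ((k : ℝ) + 1) with ht
  have ht0 : ∀ k, 0 < t k := fun k => by positivity
  have ht1 : ∀ k, t k ≤ 1 := fun k => by
    rw [ht]; simp only; rw [div_le_one (by positivity)]; linarith [Nat.cast_nonneg (α := ℝ) k]
  have htlim : Tendsto t atTop (𝓝[≠] 0) := tendsto_nhdsWithin_iff.2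
    ⟨tendsto_one_div_add_atTop_nhds_zero_nat, Eventually.of_forall fun k => (ht0 k).ne'⟩
  have h1 : Tendsto (fun k => ∫ x, (t k)⁻¹ * (φ (t k) x - φ 0 x) ∂μ) atTop
      (𝓝 (∫ x, ψ 0 x ∂μ)) := by
    refine tendsto_integral_of_lintegral_sq_le (C := C)
      (fun k => ((hφm _).sub (hφm _)).const_mul _) (by fun_prop) hC (fun k => ?_)
      (hb 0 (by simp)) (fun x => ?_)
    -- The squared difference quotient is at most the average of `ψ²` over `(0, t k]`; by Tonelli
    -- its expectation inherits the uniform bound `C`.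
    · have h2 : ∀ x, ‖(t k)⁻¹ * (φ (t k) x - φ 0 x)‖ₑ ^ 2
          ≤ (ENNReal.ofReal (t k))⁻¹ * ∫⁻ s in Set.Ioc 0 (t k), ‖ψ s x‖ₑ ^ 2 := fun x => by
        have h3 := enorm_sub_sq_le_lintegral_deriv_sq (g' := fun s => ψ s x) (by fun_prop)
          (hd x) (ht0 k).le
        have h5 : ENNReal.ofReal (t k) ≠ 0 := by simpa using ht0 k
        rw [enorm_mul, mul_pow, Real.enorm_of_nonneg (inv_nonneg.2 (ht0 k).le),
          ENNReal.ofReal_inv_of_pos (ht0 k)]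
        refine (mul_le_mul_right h3 _).trans_eq ?_
        rw [sq, mul_assoc, ← mul_assoc _ (ENNReal.ofReal (t k)),
          ENNReal.inv_mul_cancel h5 ENNReal.ofReal_ne_top, one_mul]
      have hm : Measurable (fun z : X × ℝ => ‖ψ z.2 z.1‖ₑ ^ 2) :=
        (hψm.comp measurable_swap).enorm.pow_const 2
      calc ∫⁻ x, ‖(t k)⁻¹ * (φ (t k) x - φ 0 x)‖ₑ ^ 2 ∂μ
          ≤ ∫⁻ x, (ENNReal.ofReal (t k))⁻¹ * (∫⁻ s in Set.Ioc 0 (t k), ‖ψ s x‖ₑ ^ 2) ∂μ :=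
            lintegral_mono h2
        _ = (ENNReal.ofReal (t k))⁻¹ * ∫⁻ s in Set.Ioc 0 (t k), (∫⁻ x, ‖ψ s x‖ₑ ^ 2 ∂μ) := by
            rw [lintegral_const_mul _ hm.lintegral_prod_right',
              lintegral_lintegral_swap hm.aemeasurable]
        _ ≤ (ENNReal.ofReal (t k))⁻¹ * ∫⁻ s in Set.Ioc 0 (t k), C := by
            gcongr 1
            exact setLIntegral_mono measurable_const fun s hs =>
              hb s ⟨hs.1.le, hs.2.trans (ht1 k)⟩
        _ = C := by
            rw [lintegral_const, Measure.restrict_apply MeasurableSet.univ, Set.univ_inter,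
              Real.volume_Ioc, sub_zero, mul_comm C, ← mul_assoc,
              ENNReal.inv_mul_cancel (by simpa using ht0 k) ENNReal.ofReal_ne_top, one_mul]
    · have := (hasDerivAt_iff_tendsto_slope_zero.1 (hd x 0)).comp htlim
      simpa [Function.comp_def] using this
  have h2 : Tendsto (fun k => ∫ x, (t k)⁻¹ * (φ (t k) x - φ 0 x) ∂μ) atTop (𝓝 m) := by
    have := (hasDerivAt_iff_tendsto_slope_zero.1 hΦ).comp htlim
    refine this.congr fun k => ?_
    simp only [Function.comp_apply, zero_add, smul_eq_mul]
    rw [integral_const_mul, integral_sub (hφ _) (hφ _)]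
  exact tendsto_nhds_unique h1 h2

end DifferentiationUnderTheIntegral

/-! ### Measurability and unbiasedness of stochastic gradients. -/

namespace Problem

open Filter Topology

variable {n f : ℕ} (p : Problem.{u} n f)

theorem hasDerivAt_line (x : p.X) (θ v : Param p.d) (s : ℝ) :
    HasDerivAt (fun s : ℝ => p.q (θ + s • v) x) (inner ℝ v (p.pointGrad (θ + s • v) x)) s := by
  have h1 : HasDerivAt (fun s : ℝ => θ + s • v) v s := by
    simpa using ((hasDerivAt_id s).smul_const v).const_add θ
  have h2 := (p.differentiable_q x (θ + s • v)).hasFDerivAt.comp_hasDerivAt s h1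
  rw [← inner_gradient_left] at h2
  rw [real_inner_comm]
  exact h2

/-- Each coordinate is a pointwise limit of difference quotients of the jointly measurable loss. -/
theorem measurable_pointGrad :
    Measurable (fun z : Param p.d × p.X => p.pointGrad z.1 z.2) := by
  have hcoord : Measurable (fun z : Param p.d × p.X => WithLp.ofLp (p.pointGrad z.1 z.2)) := by
    refine measurable_pi_lambda _ fun i => ?_
    set v : Param p.d := EuclideanSpace.single i 1
    have hlim : Tendsto (fun k : ℕ => 1 / ((k : ℝ) + 1)) atTop (𝓝[≠] 0) :=
      tendsto_nhdsWithin_iff.2 ⟨tendsto_one_div_add_atTop_nhds_zero_nat,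
        Eventually.of_forall fun k => (by positivity : (0 : ℝ) < 1 / ((k : ℝ) + 1)).ne'⟩
    refine measurable_of_tendsto_metrizable (f := fun (k : ℕ) (z : Param p.d × p.X) =>
      (1 / ((k : ℝ) + 1))⁻¹ * (p.q (z.1 + (1 / ((k : ℝ) + 1)) • v) z.2 - p.q z.1 z.2))
      (fun k => ?_) (tendsto_pi_nhds.2 fun z => ?_)
    · refine (Measurable.sub ?_ p.measurable_q).const_mul _
      exact p.measurable_q.comp ((measurable_fst.add_const _).prodMk measurable_snd)
    · have h := (hasDerivAt_iff_tendsto_slope_zero.1 (p.hasDerivAt_line z.2 z.1 v 0)).comp hlim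
      simp only [zero_add, zero_smul, add_zero, smul_eq_mul, Function.comp_def] at h
      simpa only [v, EuclideanSpace.inner_single_left, map_one, one_mul] using h
  exact (WithLp.measurable_toLp 2 _).comp hcoord

variable {p} {L σ : ℝ}

theorem memLp_pointGrad_sub (hσ : p.BoundedVariance σ) {i : Fin n} (hi : i ∈ p.S)
    (θ : Param p.d) :
    MemLp (fun x => p.pointGrad θ x - gradient (p.localLoss i) θ) 2 (p.D i) := by
  rw [memLp_two_iff_integrable_sq_norm]
  · exact (hσ i hi θ).1
  · exact ((p.measurable_pointGrad.comp measurable_prodMk_left).sub_const _).aestronglyMeasurable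

theorem integrable_pointGrad (hσ : p.BoundedVariance σ) {i : Fin n} (hi : i ∈ p.S)
    (θ : Param p.d) : Integrable (p.pointGrad θ) (p.D i) := by
  have := ((memLp_pointGrad_sub hσ hi θ).integrable (by norm_num)).add
    (integrable_const (gradient (p.localLoss i) θ))
  simpa [Pi.add_def] using this

/-- The stochastic gradients are unbiased. -/
theorem integral_pointGrad (hL0 : 0 ≤ L) (hL : p.LipschitzSmooth L) (hσ : p.BoundedVariance σ)
    {i : Fin n} (hi : i ∈ p.S) (θ : Param p.d) :
    ∫ x, p.pointGrad θ x ∂(p.D i) = gradient (p.localLoss i) θ := by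
  -- Tested against `v`, the claim concerns derivatives along the line `θ + s v`. For `s` in `[0,
  -- 1]` the variance bound and the Lipschitz gradient give a uniform `L²` bound on the directional
  -- derivatives.
  refine ext_inner_left ℝ fun v => ?_
  rw [← integral_inner (integrable_pointGrad hσ hi θ)]
  set G := gradient (p.localLoss i)
  set B := 2 * σ ^ 2 + 2 * (‖G θ‖ + L * ‖v‖) ^ 2
  have hmeas : Measurable (Function.uncurry fun (s : ℝ) x =>
      (inner ℝ v (p.pointGrad (θ + s • v) x) : ℝ)) := by
    have h1 : Measurable (fun z : ℝ × p.X => p.pointGrad (θ + z.1 • v) z.2) :=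
      p.measurable_pointGrad.comp
        (((measurable_fst.smul_const v).const_add θ).prodMk measurable_snd)
    exact measurable_const.inner h1
  have h := integral_deriv_eq_of_lintegral_sq_le (μ := p.D i)
    (φ := fun s x => p.q (θ + s • v) x) (ψ := fun s x => inner ℝ v (p.pointGrad (θ + s • v) x))
    (C := ENNReal.ofReal (‖v‖ ^ 2 * B)) (m := inner ℝ v (G θ))
    (fun s => p.measurable_q.comp measurable_prodMk_left) (fun s => p.integrable_q i hi _) hmeas
    (fun x s => p.hasDerivAt_line x θ v s) ENNReal.ofReal_ne_top (fun s hs => ?_) ?_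
  · simpa using h
  · have hG : ‖G (θ + s • v)‖ ≤ ‖G θ‖ + L * ‖v‖ := by
      have h1 := (hL i hi).2 (θ + s • v) θ
      rw [add_sub_cancel_left, norm_smul, Real.norm_of_nonneg hs.1] at h1
      have h2 := norm_le_norm_add_norm_sub' (G (θ + s • v)) (G θ)
      have h3 : L * (s * ‖v‖) ≤ L * ‖v‖ :=
        mul_le_mul_of_nonneg_left (mul_le_of_le_one_left (norm_nonneg v) hs.2) hL0
      linarith
    have hpt : ∀ x, ‖(inner ℝ v (p.pointGrad (θ + s • v) x) : ℝ)‖ₑ ^ 2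
        ≤ ENNReal.ofReal (‖v‖ ^ 2 * (2 * ‖p.pointGrad (θ + s • v) x - G (θ + s • v)‖ ^ 2
          + 2 * (‖G θ‖ + L * ‖v‖) ^ 2)) := fun x => by
      rw [← ofReal_norm, ← ENNReal.ofReal_pow (norm_nonneg _)]
      refine ENNReal.ofReal_le_ofReal ?_
      have h1 : ‖(inner ℝ v (p.pointGrad (θ + s • v) x) : ℝ)‖ ^ 2
          ≤ (‖v‖ * ‖p.pointGrad (θ + s • v) x‖) ^ 2 := by
        gcongr; exact norm_inner_le_norm _ _
      have h2 := norm_add_sq_le_two (p.pointGrad (θ + s • v) x - G (θ + s • v)) (G (θ + s • v))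
      rw [sub_add_cancel] at h2
      have h3 : ‖G (θ + s • v)‖ ^ 2 ≤ (‖G θ‖ + L * ‖v‖) ^ 2 := by gcongr
      rw [mul_pow] at h1
      refine h1.trans ?_
      gcongr
      linarith
    refine (lintegral_mono hpt).trans ?_
    have hv := (hσ i hi (θ + s • v))
    rw [← ofReal_integral_eq_lintegral_ofReal]
    · refine ENNReal.ofReal_le_ofReal ?_
      rw [integral_const_mul, integral_add (hv.1.const_mul 2) (integrable_const _),
        integral_const_mul, integral_const]
      simp only [probReal_univ, one_smul]
      gcongr
      exact add_le_add_left (mul_le_mul_of_nonneg_left hv.2 zero_le_two) _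
    · exact ((hv.1.const_mul 2).add (integrable_const _)).const_mul _
    · exact ae_of_all _ fun x => by positivity
  · have h1 : HasDerivAt (fun s : ℝ => θ + s • v) v 0 := by
      simpa using ((hasDerivAt_id (0 : ℝ)).smul_const v).const_add θ
    have h2 := ((hL i hi).1 (θ + (0 : ℝ) • v)).hasFDerivAt.comp_hasDerivAt (0 : ℝ) h1
    rw [← inner_gradient_left, zero_smul, add_zero, real_inner_comm] at h2
    exact h2

end Problem

/-! ### Second moments of independent centered sums. -/

section ProductMeasure

/-- The second moment of a sum of independent centered vectors. -/
theorem lintegral_sq_norm_add_sum_le {ι X : Type*} [Fintype ι] [MeasurableSpace X]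
    {D : ι → Measure X} [∀ i, IsProbabilityMeasure (D i)] {d : ℕ} {ψ : ι → X → Param d} {V : ℝ}
    (hψ : ∀ i, MemLp (ψ i) 2 (D i)) (h0 : ∀ i, ∫ x, ψ i x ∂(D i) = 0)
    (hV : ∀ i, ∫ x, ‖ψ i x‖ ^ 2 ∂(D i) ≤ V) (a : ι → ℝ) (y : Param d) :
    ∫⁻ x, ‖y + ∑ i, a i • ψ i (x i)‖ₑ ^ 2 ∂(Measure.pi D)
      ≤ ‖y‖ₑ ^ 2 + ENNReal.ofReal ((∑ i, a i ^ 2) * V) := by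
  classical
  have hmem : ∀ i, MemLp (fun x : ι → X => ψ i (x i)) 2 (Measure.pi D) := fun i =>
    (hψ i).comp_measurePreserving (measurePreserving_eval D i)
  have hmean : ∀ i, ∫ x, ψ i (x i) ∂(Measure.pi D) = 0 := fun i => by
    rw [integral_comp_eval (hψ i).1, h0]
  have hindep := iIndepFun_pi (μ := D) (X := ψ) (fun i => (hψ i).1.aemeasurable)
  have hZ : MemLp (fun x : ι → X => ∑ i, a i • ψ i (x i)) 2 (Measure.pi D) :=
    memLp_finsetSum _ fun i _ => (hmem i).const_smul (a i)
  have hZmean : ∫ x, ∑ i, a i • ψ i (x i) ∂(Measure.pi D) = 0 := by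
    rw [integral_finsetSum (f := fun i (x : ι → X) => a i • ψ i (x i)) _
      fun i _ => ((hmem i).const_smul (a i)).integrable (by norm_num)]
    simp only [integral_smul, hmean, smul_zero, Finset.sum_const_zero]
  have hinner : ∀ i j, Integrable
      (fun x : ι → X => (inner ℝ (ψ i (x i)) (ψ j (x j)) : ℝ)) (Measure.pi D) := fun i j =>
    (L2.integrable_inner ((hmem i).toLp _) ((hmem j).toLp _)).congr (by
      filter_upwards [(hmem i).coeFn_toLp, (hmem j).coeFn_toLp] with x hx hx'
      rw [hx, hx'])
  have hcross : ∀ i j, i ≠ j →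
      ∫ x, (inner ℝ (ψ i (x i)) (ψ j (x j)) : ℝ) ∂(Measure.pi D) = 0 := fun i j hij => by
    have : ∫ x, (inner ℝ (ψ i (x i)) (ψ j (x j)) : ℝ) ∂(Measure.pi D)
        = inner ℝ (∫ x, ψ i (x i) ∂(Measure.pi D)) (∫ x, ψ j (x j) ∂(Measure.pi D)) :=
      (hindep.indepFun hij).integral_bilin ((hmem i).integrable (by norm_num))
        ((hmem j).integrable (by norm_num)) (innerSL ℝ)
    rw [this, hmean, inner_zero_left]
  have hdiag : ∀ i, ∫ x, (inner ℝ (ψ i (x i)) (ψ i (x i)) : ℝ) ∂(Measure.pi D) ≤ V := fun i => by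
    simp only [real_inner_self_eq_norm_sq]
    rw [integral_comp_eval (μ := D) (i := i) (f := fun x => ‖ψ i x‖ ^ 2) ((hψ i).1.norm.pow 2)]
    exact hV i
  have hZsq : ∫ x, ‖∑ i, a i • ψ i (x i)‖ ^ 2 ∂(Measure.pi D) ≤ (∑ i, a i ^ 2) * V := by
    have hexp : ∀ x : ι → X, ‖∑ i, a i • ψ i (x i)‖ ^ 2
        = ∑ i, ∑ j, a i * a j * inner ℝ (ψ i (x i)) (ψ j (x j)) := fun x => by
      rw [← real_inner_self_eq_norm_sq, sum_inner]
      refine Finset.sum_congr rfl fun i _ => ?_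
      rw [inner_sum]
      refine Finset.sum_congr rfl fun j _ => ?_
      rw [real_inner_smul_left, real_inner_smul_right, mul_assoc]
    simp only [hexp]
    rw [integral_finsetSum _ fun i _ => integrable_finsetSum _ fun j _ =>
      (hinner i j).const_mul _, Finset.sum_mul]
    refine Finset.sum_le_sum fun i _ => ?_
    rw [integral_finsetSum _ fun j _ => (hinner i j).const_mul _,
      Finset.sum_eq_single i, integral_const_mul, ← sq]
    · exact mul_le_mul_of_nonneg_left (hdiag i) (sq_nonneg _)
    · intro j _ hj
      rw [integral_const_mul, hcross i j hj.symm, mul_zero]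
    · simp
  have hsum : MemLp (fun x : ι → X => y + ∑ i, a i • ψ i (x i)) 2 (Measure.pi D) :=
    (memLp_const y).add hZ
  have hi : Integrable (fun x : ι → X => ‖y + ∑ i, a i • ψ i (x i)‖ ^ 2) (Measure.pi D) :=
    (memLp_two_iff_integrable_sq_norm hsum.1).1 hsum
  have hiZ : Integrable (fun x : ι → X => ‖∑ i, a i • ψ i (x i)‖ ^ 2) (Measure.pi D) :=
    (memLp_two_iff_integrable_sq_norm hZ.1).1 hZ
  have hconv : ∀ v : Param d, ‖v‖ₑ ^ 2 = ENNReal.ofReal (‖v‖ ^ 2) := fun v => by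
    rw [ENNReal.ofReal_pow (norm_nonneg _), ofReal_norm]
  simp only [hconv]
  rw [← ofReal_integral_eq_lintegral_ofReal hi (ae_of_all _ fun x => by positivity)]
  refine (ENNReal.ofReal_le_ofReal ?_).trans ENNReal.ofReal_add_le
  simp only [norm_add_sq_real]
  have hZi := hZ.integrable (q := 2) (by norm_num)
  have hin : Integrable (fun x : ι → X => 2 * (inner ℝ y (∑ i, a i • ψ i (x i)) : ℝ))
      (Measure.pi D) := (hZi.const_inner y).const_mul 2
  have hin' : Integrable (fun x : ι → X => ‖y‖ ^ 2 + 2 * (inner ℝ y (∑ i, a i • ψ i (x i)) : ℝ))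
      (Measure.pi D) := (integrable_const _).add hin
  rw [integral_add hin' hiZ, integral_add (integrable_const _) hin, integral_const_mul,
    integral_inner hZi, hZmean, inner_zero_right, mul_zero, integral_const, probReal_univ,
    one_smul, add_zero]
  linarith

end ProductMeasure

namespace Problem

variable {n f : ℕ} {p : Problem.{u} n f} {L σ ζ : ℝ}

theorem continuous_gradient_localLoss (hL : p.LipschitzSmooth L) {i : Fin n} (hi : i ∈ p.S) :
    Continuous (gradient (p.localLoss i)) := by
  refine (LipschitzWith.of_dist_le_mul (K := L.toNNReal) fun x y => ?_).continuous
  rw [dist_eq_norm, dist_eq_norm]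
  exact ((hL i hi).2 x y).trans
    (mul_le_mul_of_nonneg_right (Real.le_coe_toNNReal L) (norm_nonneg _))

theorem integral_noise_eq_zero (hL0 : 0 ≤ L) (hL : p.LipschitzSmooth L)
    (hσ : p.BoundedVariance σ) {i : Fin n} (hi : i ∈ p.S) (θ : Param p.d) :
    ∫ x, (p.pointGrad θ x - gradient (p.localLoss i) θ) ∂(p.D i) = 0 := by
  rw [integral_sub (integrable_pointGrad hσ hi θ) (integrable_const _),
    integral_pointGrad hL0 hL hσ hi θ, integral_const, probReal_univ, one_smul, sub_self]

end Problem

/-! ### Noise accumulated in the momentum. -/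

namespace Execution

variable {n f : ℕ} {p : Problem.{u} n f} {θ₀ : Param p.d} {β γ : ℝ} {K T : ℕ} {Ω : Type v}
  [mΩ : MeasurableSpace Ω] {P : Measure Ω} {L σ ζ : ℝ}

/-- The error of the stochastic gradient of node `i` in iteration `t`. -/
noncomputable def noise (e : Execution p θ₀ β γ K T P) (t : ℕ) (i : Fin n) (ω : Ω) : Param p.d :=
  p.pointGrad (e.model t i ω) (e.sample t i ω) - gradient (p.localLoss i) (e.model t i ω)

theorem measurable_noise (e : Execution p θ₀ β γ K T P) (hL : p.LipschitzSmooth L) {t : ℕ}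
    (ht : t < T) {i : Fin n} (hi : i ∈ p.S) : Measurable[e.hist (t + 1)] (e.noise t i) := by
  have h1 : Measurable[e.hist (t + 1)] (e.model t i) :=
    (e.model_measurable t ht.le i hi).mono (e.hist.mono t.le_succ) le_rfl
  have h2 := e.sample_measurable t ht i hi
  have h3 : Measurable[e.hist (t + 1)]
      (fun ω => p.pointGrad (e.model t i ω) (e.sample t i ω)) :=
    p.measurable_pointGrad.comp (h1.prodMk h2)
  exact h3.sub ((Problem.continuous_gradient_localLoss hL hi).measurable.comp h1)

/-- Adding a combination of the noise of iteration `t` to a vector known before. -/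
theorem lintegral_sq_norm_add_noise_le [IsProbabilityMeasure P]
    (e : Execution p θ₀ β γ K T P) (hL0 : 0 ≤ L) (hL : p.LipschitzSmooth L)
    (hσ : p.BoundedVariance σ) {t : ℕ} (ht : t < T) {Y : Ω → Param p.d}
    (hY : Measurable[e.hist t] Y) (a : p.S → ℝ) :
    ∫⁻ ω, ‖Y ω + ∑ i : p.S, a i • e.noise t i ω‖ₑ ^ 2 ∂P
      ≤ ∫⁻ ω, ‖Y ω‖ₑ ^ 2 ∂P + ENNReal.ofReal ((∑ i, a i ^ 2) * σ ^ 2) := by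
  set W : Ω → Param p.d × (p.S → Param p.d) := fun ω => (Y ω, fun i => e.model t i ω) with hW
  set U : Ω → p.S → p.X := fun ω i => e.sample t i ω with hU
  have hWm : Measurable[e.hist t] W :=
    hY.prodMk ((@measurable_pi_iff Ω p.S (fun _ => Param p.d) (e.hist t) _ _).2
      fun i => e.model_measurable t ht.le i i.2)
  have hWm' : Measurable W := hWm.mono (e.hist.le t) le_rfl
  have hUm : Measurable U := measurable_pi_lambda _ fun i =>
    (e.sample_measurable t ht i i.2).mono (e.hist.le _) le_rfl
  -- All that depends on the past is collected in `W`; independence lets it be frozen while the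
  -- fresh samples `U` are integrated against the product law, under which the noise is centered.
  have hind : IndepFun W U P :=
    indep_of_indep_of_le_left (e.sample_indep t ht) hWm.comap_le
  have hmap := (indepFun_iff_map_prod_eq_prod_map_map hWm'.aemeasurable hUm.aemeasurable).1 hind
  rw [e.sample_law t ht] at hmap
  set F : (Param p.d × (p.S → Param p.d)) × (p.S → p.X) → ENNReal := fun z =>
    ‖z.1.1 + ∑ i : p.S, a i • (p.pointGrad (z.1.2 i) (z.2 i)
      - gradient (p.localLoss i) (z.1.2 i))‖ₑ ^ 2 with hF
  have hFm : Measurable F := by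
    refine Measurable.pow_const (Measurable.enorm ?_) 2
    refine (measurable_fst.comp measurable_fst).add
      (Finset.measurable_sum _ fun i _ => ?_)
    have h1 : Measurable fun z : (Param p.d × (p.S → Param p.d)) × (p.S → p.X) => z.1.2 i := by
      fun_prop
    have h2 : Measurable fun z : (Param p.d × (p.S → Param p.d)) × (p.S → p.X) => z.2 i := by
      fun_prop
    exact ((p.measurable_pointGrad.comp (h1.prodMk h2)).sub
      ((Problem.continuous_gradient_localLoss hL i.2).measurable.comp h1)).const_smul (a i)
  calc ∫⁻ ω, ‖Y ω + ∑ i : p.S, a i • e.noise t i ω‖ₑ ^ 2 ∂P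
      = ∫⁻ ω, F (W ω, U ω) ∂P := rfl
    _ = ∫⁻ w, ∫⁻ x, F (w, x) ∂(Measure.pi fun i : p.S => p.D i) ∂(P.map W) := by
        rw [← lintegral_map hFm (hWm'.prodMk hUm), hmap, lintegral_prod _ hFm.aemeasurable]
    _ ≤ ∫⁻ w, (‖w.1‖ₑ ^ 2 + ENNReal.ofReal ((∑ i, a i ^ 2) * σ ^ 2)) ∂(P.map W) :=
        lintegral_mono fun w => lintegral_sq_norm_add_sum_le (D := fun i : p.S => p.D i)
          (ψ := fun i x => p.pointGrad (w.2 i) x - gradient (p.localLoss i) (w.2 i))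
          (fun i => Problem.memLp_pointGrad_sub hσ i.2 _)
          (fun i => Problem.integral_noise_eq_zero hL0 hL hσ i.2 _)
          (fun i => (hσ i i.2 _).2) a w.1
    _ = ∫⁻ ω, ‖Y ω‖ₑ ^ 2 ∂P + ENNReal.ofReal ((∑ i, a i ^ 2) * σ ^ 2) := by
        rw [lintegral_map (by fun_prop) hWm', lintegral_add_right _ measurable_const,
          lintegral_const, measure_univ, mul_one]

theorem measurable_ema_noise (e : Execution p θ₀ β γ K T P) (hL : p.LipschitzSmooth L)
    (a : p.S → ℝ) {t : ℕ} (ht : t ≤ T) :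
    Measurable[e.hist t] (fun ω => ema β (fun s => ∑ i : p.S, a i • e.noise s i ω) t) := by
  induction t with
  | zero => exact measurable_const
  | succ t ih =>
    have h1 := (ih (by omega)).mono (e.hist.mono t.le_succ) le_rfl
    have h2 : Measurable[e.hist (t + 1)] (fun ω => ∑ i : p.S, a i • e.noise t i ω) :=
      Finset.measurable_sum _ fun i _ => (e.measurable_noise hL (by omega) i.2).const_smul (a i)
    exact (h1.const_smul β).add (h2.const_smul (1 - β))

/-- The new noise is centered given the past, so second moments satisfy `V' ≤ β² V + (1-β)² A`, and
`(1-β) A` is preserved because `β² ≤ β`. Lower integrals avoid assuming integrability, which follows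
from the bound. -/
theorem lintegral_sq_norm_ema_noise_le [IsProbabilityMeasure P]
    (e : Execution p θ₀ β γ K T P) (hL0 : 0 ≤ L) (hL : p.LipschitzSmooth L)
    (hσ : p.BoundedVariance σ) (h0 : 0 ≤ β) (h1 : β ≤ 1) (a : p.S → ℝ) {t : ℕ} (ht : t ≤ T) :
    ∫⁻ ω, ‖ema β (fun s => ∑ i : p.S, a i • e.noise s i ω) t‖ₑ ^ 2 ∂P
      ≤ ENNReal.ofReal ((1 - β) * ((∑ i, a i ^ 2) * σ ^ 2)) := by
  set A := (∑ i, a i ^ 2) * σ ^ 2 with hA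
  have hA0 : 0 ≤ A := mul_nonneg (Finset.sum_nonneg fun _ _ => sq_nonneg _) (sq_nonneg _)
  have hβ : 0 ≤ 1 - β := by linarith
  induction t with
  | zero => simp [ema]
  | succ t ih =>
    have hm := (e.measurable_ema_noise hL a (t := t) (by omega)).const_smul β
    have h := e.lintegral_sq_norm_add_noise_le hL0 hL hσ (t := t) (by omega) hm
      (fun i => (1 - β) * a i)
    have hs : ∑ i, ((1 - β) * a i) ^ 2 = (1 - β) ^ 2 * ∑ i, a i ^ 2 := by
      simp only [mul_pow, Finset.mul_sum]
    have hb : ∫⁻ ω, ‖β • ema β (fun s => ∑ i : p.S, a i • e.noise s i ω) t‖ₑ ^ 2 ∂P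
        ≤ ENNReal.ofReal (β ^ 2 * ((1 - β) * A)) := by
      simp only [enorm_smul, mul_pow, Real.enorm_of_nonneg h0]
      have hm' : Measurable (fun ω => ema β (fun s => ∑ i : p.S, a i • e.noise s i ω) t) :=
        (e.measurable_ema_noise hL a (t := t) (by omega)).mono (e.hist.le t) le_rfl
      rw [lintegral_const_mul _ (hm'.enorm.pow_const 2), ENNReal.ofReal_mul (sq_nonneg β),
        ENNReal.ofReal_pow h0]
      gcongr
      exact ih (by omega)
    calc ∫⁻ ω, ‖ema β (fun s => ∑ i : p.S, a i • e.noise s i ω) (t + 1)‖ₑ ^ 2 ∂P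
        = ∫⁻ ω, ‖β • ema β (fun s => ∑ i : p.S, a i • e.noise s i ω) t
          + ∑ i : p.S, ((1 - β) * a i) • e.noise t i ω‖ₑ ^ 2 ∂P := by
          simp only [ema, Finset.smul_sum, smul_smul]
      _ ≤ ENNReal.ofReal (β ^ 2 * ((1 - β) * A)) + ENNReal.ofReal ((1 - β) ^ 2 * A) := by
          refine h.trans (add_le_add hb (le_of_eq ?_))
          rw [hs, mul_assoc]
      _ ≤ ENNReal.ofReal ((1 - β) * A) := by
          rw [← ENNReal.ofReal_add (by positivity) (by positivity)]
          refine ENNReal.ofReal_le_ofReal ?_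
          nlinarith [mul_nonneg (mul_nonneg hβ hβ) (mul_nonneg h0 hA0)]

end Execution

/-! ### The average loss of the correct nodes. -/

namespace Problem

variable {n f : ℕ} {p : Problem.{u} n f} {L σ ζ : ℝ}

theorem nonempty_S (hn : 1 ≤ n) (hf : 11 * f ≤ n) : p.S.Nonempty := by
  have := p.card_S
  rw [← Finset.card_pos]; omega

theorem card_S_eq : (p.S.card : ℝ) = n - f := by
  have := congrArg (Nat.cast (R := ℝ)) p.card_S
  push_cast at this
  linarith

theorem hasGradientAt_avgLoss (hL : p.LipschitzSmooth L) (θ : Param p.d) :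
    HasGradientAt p.avgLoss (mean p.S fun i => gradient (p.localLoss i) θ) θ := by
  have h : HasFDerivAt p.avgLoss
      ((p.S.card : ℝ)⁻¹ • ∑ i ∈ p.S, fderiv ℝ (p.localLoss i) θ) θ :=
    (HasFDerivAt.fun_sum (u := p.S) fun i hi => ((hL i hi).1 θ).hasFDerivAt).const_mul _
  have he : InnerProductSpace.toDual ℝ (Param p.d)
      (mean p.S fun i => gradient (p.localLoss i) θ)
      = (p.S.card : ℝ)⁻¹ • ∑ i ∈ p.S, fderiv ℝ (p.localLoss i) θ := by
    rw [mean, map_smul, map_sum]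
    simp only [toDual_gradient]
  rw [hasGradientAt_iff_hasFDerivAt, he]
  exact h

theorem gradient_avgLoss (hL : p.LipschitzSmooth L) (θ : Param p.d) :
    gradient p.avgLoss θ = mean p.S fun i => gradient (p.localLoss i) θ :=
  (hasGradientAt_avgLoss hL θ).gradient

theorem differentiable_avgLoss (hL : p.LipschitzSmooth L) : Differentiable ℝ p.avgLoss :=
  fun θ => (hasGradientAt_avgLoss hL θ).differentiableAt

theorem continuous_gradient_avgLoss (hL : p.LipschitzSmooth L) :
    Continuous (gradient p.avgLoss) := by
  rw [funext (gradient_avgLoss hL)]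
  have : Continuous fun θ => ∑ i ∈ p.S, gradient (p.localLoss i) θ :=
    continuous_finsetSum _ fun i hi => continuous_gradient_localLoss hL hi
  exact this.const_smul (p.S.card : ℝ)⁻¹

end Problem

/-! ### From executions to expected gradients. -/

namespace Execution

variable {n f : ℕ} {p : Problem.{u} n f} {θ₀ : Param p.d} {β γ : ℝ} {K T : ℕ} {Ω : Type v}
  [mΩ : MeasurableSpace Ω] {P : Measure Ω} {L σ ζ : ℝ}

section Moments

variable [IsProbabilityMeasure P] (e : Execution p θ₀ β γ K T P) (hL0 : 0 ≤ L)
  (hL : p.LipschitzSmooth L) (hσ : p.BoundedVariance σ) (h0 : 0 ≤ β) (h1 : β ≤ 1)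

include hL0 hL hσ h0 h1

theorem integral_sq_norm_ema_noise_le (a : p.S → ℝ) {t : ℕ} (ht : t ≤ T) :
    Integrable (fun ω => ‖ema β (fun s => ∑ i : p.S, a i • e.noise s i ω) t‖ ^ 2) P ∧
    ∫ ω, ‖ema β (fun s => ∑ i : p.S, a i • e.noise s i ω) t‖ ^ 2 ∂P
      ≤ (1 - β) * ((∑ i, a i ^ 2) * σ ^ 2) := by
  have hm : Measurable (fun ω => ema β (fun s => ∑ i : p.S, a i • e.noise s i ω) t) :=
    (e.measurable_ema_noise hL a ht).mono (e.hist.le t) le_rfl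
  have h := e.lintegral_sq_norm_ema_noise_le hL0 hL hσ h0 h1 a ht
  have hconv : ∀ v : Param p.d, ‖v‖ₑ ^ 2 = ENNReal.ofReal (‖v‖ ^ 2) := fun v => by
    rw [ENNReal.ofReal_pow (norm_nonneg _), ofReal_norm]
  simp only [hconv] at h
  have hms : AEStronglyMeasurable
      (fun ω => ‖ema β (fun s => ∑ i : p.S, a i • e.noise s i ω) t‖ ^ 2) P :=
    (hm.norm.pow_const 2).aestronglyMeasurable
  have hnn : 0 ≤ᵐ[P] fun ω => ‖ema β (fun s => ∑ i : p.S, a i • e.noise s i ω) t‖ ^ 2 :=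
    ae_of_all _ fun ω => by positivity
  refine ⟨(lintegral_ofReal_ne_top_iff_integrable hms hnn).1
    (h.trans_lt ENNReal.ofReal_lt_top).ne, ?_⟩
  rw [integral_eq_lintegral_of_nonneg_ae hnn hms]
  refine ENNReal.toReal_le_of_le_ofReal ?_ h
  exact mul_nonneg (by linarith)
    (mul_nonneg (Finset.sum_nonneg fun _ _ => sq_nonneg _) (sq_nonneg _))

theorem integral_sq_norm_ema_noise_node_le {i : Fin n} (hi : i ∈ p.S) {t : ℕ} (ht : t ≤ T) :
    Integrable (fun ω => ‖ema β (fun s => e.noise s i ω) t‖ ^ 2) P ∧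
    ∫ ω, ‖ema β (fun s => e.noise s i ω) t‖ ^ 2 ∂P ≤ (1 - β) * σ ^ 2 := by
  classical
  have h := e.integral_sq_norm_ema_noise_le hL0 hL hσ h0 h1
    (fun j => if j = ⟨i, hi⟩ then 1 else 0) ht
  simpa using h

/-- Equal weights `1/|S|` on independent noises have square sum `1/|S|`: this is the variance
reduction by collaboration. -/
theorem integral_sq_norm_mean_ema_noise_le {t : ℕ} (ht : t ≤ T) :
    Integrable (fun ω => ‖mean p.S (fun i => ema β (fun s => e.noise s i ω) t)‖ ^ 2) P ∧
    ∫ ω, ‖mean p.S (fun i => ema β (fun s => e.noise s i ω) t)‖ ^ 2 ∂P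
      ≤ (1 - β) * ((p.S.card : ℝ)⁻¹ * σ ^ 2) := by
  have h := e.integral_sq_norm_ema_noise_le hL0 hL hσ h0 h1 (fun _ => (p.S.card : ℝ)⁻¹) ht
  have hs : ∑ _i : p.S, ((p.S.card : ℝ)⁻¹) ^ 2 = (p.S.card : ℝ)⁻¹ := by
    rcases eq_or_ne (p.S.card : ℝ) 0 with h0 | h0
    · simp [h0]
    · simp only [Finset.sum_const, Finset.card_univ, Fintype.card_coe, nsmul_eq_mul]
      field_simp
  have hmean : ∀ s ω, ∑ i : p.S, (p.S.card : ℝ)⁻¹ • e.noise s i ω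
      = mean p.S (fun i => e.noise s i ω) := fun s ω => by
    rw [← Finset.smul_sum, mean, Finset.sum_coe_sort p.S (fun i => e.noise s i ω)]
  simp only [hs, hmean] at h
  simp only [mean_ema p.S β (fun s i => e.noise s i _)]
  exact h

end Moments

/-- Every sample path qualifies, whatever the adversary does. The drift constant is `13 f / (n -
f)`; `lam n f` enters only through `c₂`. -/
theorem trajectory (e : Execution p θ₀ β γ 1 T P) (hn : 1 ≤ n) (hf : 11 * f ≤ n) (hL0 : 0 < L)
    (hL : p.LipschitzSmooth L) (hζ : p.Heterogeneous ζ) (hγ : 0 < γ) (hγ' : 12 * γ * L ≤ 1)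
    (h0 : 0 ≤ β) (h1 : 6 * γ * L ≤ 1 - β) (hα : alpha n f < 1)
    (hsmall : 4 * L ^ 2 * (2 * alpha n f * (1 + alpha n f) / (1 - alpha n f) ^ 2) * γ ^ 2 ≤ 1 / 2)
    (ω : Ω) :
    Trajectory p.S (fun i => gradient (p.localLoss i)) L ζ β γ (alpha n f)
      (13 * (f / ((n : ℝ) - f))) T θ₀ (fun t i => e.model t i ω) (fun t i => e.noise t i ω) := by
  have hnf : 0 ≤ (n : ℝ) - f := by
    rw [← p.card_S_eq]; positivity
  have hz : ∀ t < T, ∀ i ∈ p.S, e.vec t 0 i ω = e.model t i ω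
      - γ • ema β (fun s => gradient (p.localLoss i) (e.model s i ω) + e.noise s i ω) (t + 1) :=
    fun t ht i hi => by
      rw [e.vec_zero t ht i hi, momentum_eq_ema]
      simp only [noise, add_sub_cancel]
  have hR : ∀ t < T, ∀ i ∈ p.S, i ∉ e.received t 0 i ω ∧ (e.received t 0 i ω).card = n - f - 1 :=
    fun t ht i hi => e.received_card t ht 0 one_pos i hi ω
  have hnna : ∀ t < T, ∀ i ∈ p.S, IsNNA n f (e.vec t 0 i ω) (fun j => e.vec t 0 j ω)
      (e.received t 0 i ω) (e.model (t + 1) i ω) := fun t ht i hi => by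
    rw [e.model_succ t ht i hi]
    exact e.vec_succ t ht 0 one_pos i hi ω
  exact
  { nonempty := p.nonempty_S hn hf
    L_pos := hL0
    γ_pos := hγ
    γ_le := hγ'
    β_nonneg := h0
    β_le := h1
    α_nonneg := by unfold alpha; positivity
    α_lt := hα
    lam_nonneg := by positivity
    small := hsmall
    lipschitz := fun i hi => (hL i hi).2
    hetero := fun x => by
      have := hζ x
      rwa [Problem.gradient_avgLoss hL] at this
    init := fun i hi => e.model_zero i hi ω
    contract := fun t ht => by
      rw [← spread_congr (hz t ht)]
      exact nna_spread_le hn hf p.card_S (hR t ht) (hnna t ht)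
    drift := fun t ht => by
      rw [← spread_congr (hz t ht), ← mean_congr (hz t ht)]
      exact nna_mean_sq_le hn hf p.card_S (hR t ht) (hnna t ht) }

/-- The expectation at the returned model is the average over the iterations. -/
theorem integral_output [IsProbabilityMeasure P] (e : Execution p θ₀ β γ K T P) {i : Fin n}
    (hi : i ∈ p.S) {F : Param p.d → ℝ} (hF : Measurable F)
    (hint : ∀ t < T, Integrable (fun ω => F (e.model t i ω)) P) :
    Integrable (fun ω => F (e.output i ω)) P ∧
    ∫ ω, F (e.output i ω) ∂P = (T : ℝ)⁻¹ * ∑ t ∈ Finset.range T, ∫ ω, F (e.model t i ω) ∂P := by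
  have hmeas : ∀ t : Fin T, MeasurableSet (e.outIdx i ⁻¹' {t}) := fun t =>
    e.outIdx_measurable i hi (measurableSet_singleton t)
  have hsplit : (fun ω => F (e.output i ω)) = fun ω => ∑ t : Fin T,
      (e.outIdx i ⁻¹' {t}).indicator (fun ω => F (e.model t i ω)) ω := by
    funext ω
    rw [Finset.sum_eq_single (e.outIdx i ω)]
    · rw [Set.indicator_of_mem (by simp), output]
    · intro t _ ht
      exact Set.indicator_of_notMem (by simpa using ht.symm) _
    · simp
  have hint' : ∀ t : Fin T, Integrable
      ((e.outIdx i ⁻¹' {t}).indicator (fun ω => F (e.model t i ω))) P := fun t =>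
    (hint t t.2).indicator (hmeas t)
  rw [hsplit]
  refine ⟨integrable_finsetSum _ fun t _ => hint' t, ?_⟩
  rw [integral_finsetSum _ fun t _ => hint' t, Finset.sum_range, Finset.mul_sum]
  refine Finset.sum_congr rfl fun t _ => ?_
  have hm : Measurable[e.hist T] (e.model t i) :=
    (e.model_measurable t t.2.le i hi).mono (e.hist.mono t.2.le) le_rfl
  have hind : Indep (MeasurableSpace.comap (e.outIdx i) inferInstance)
      (MeasurableSpace.comap (e.model t i) inferInstance) P :=
    (indep_of_indep_of_le_left (e.outIdx_indep i hi) hm.comap_le).symm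
  have := hind.setIntegral_eq_mul (e.outIdx_measurable i hi).comap_le
    (hm.mono (e.hist.le T) le_rfl).aemeasurable ⟨{t}, measurableSet_singleton t, rfl⟩
    hF.aestronglyMeasurable
  rw [integral_indicator (hmeas t), this, measureReal_def, e.outIdx_law i hi t]
  simp

/-- The convergence bound for general parameters. -/
theorem integral_sq_gradient_output_le [IsProbabilityMeasure P] (e : Execution p θ₀ β γ 1 T P)
    (hn : 1 ≤ n) (hf : 11 * f ≤ n) (hT : 1 ≤ T) (hL0 : 0 < L) (hL : p.LipschitzSmooth L)
    (hσ : p.BoundedVariance σ) (hζ : p.Heterogeneous ζ) (hb : BddBelow (Set.range p.avgLoss))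
    (hγ : 0 < γ) (hγ' : 12 * γ * L ≤ 1) (h0 : 0 ≤ β) (h1 : 6 * γ * L ≤ 1 - β)
    (hα : alpha n f < 1)
    (hsmall : 4 * L ^ 2 * (2 * alpha n f * (1 + alpha n f) / (1 - alpha n f) ^ 2) * γ ^ 2 ≤ 1 / 2)
    {κ : ℝ} (hκ : κ = 2 * alpha n f * (1 + alpha n f) / (1 - alpha n f) ^ 2)
    {i : Fin n} (hi : i ∈ p.S) :
    Integrable (fun ω => ‖gradient p.avgLoss (e.output i ω)‖ ^ 2) P ∧
    ∫ ω, ‖gradient p.avgLoss (e.output i ω)‖ ^ 2 ∂P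
      ≤ 6 * p.gap θ₀ / (γ * T) + 6 * ((1 - β) * (((n : ℝ) - f)⁻¹ * σ ^ 2))
        + (κ / 2 + 48 * (13 * (f / ((n : ℝ) - f))) * (κ + 1)
            + 8 * L ^ 2 * ((n : ℝ) - f) * κ * γ ^ 2) * ((1 - β) * σ ^ 2 + 2 * ζ ^ 2) := by
  have htraj := e.trajectory hn hf hL0 hL hζ hγ hγ' h0 h1 hα hsmall
  have hG := Problem.gradient_avgLoss hL
  have hQ := Problem.differentiable_avgLoss hL
  have hGm : Measurable fun θ => ‖gradient p.avgLoss θ‖ ^ 2 :=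
    (Problem.continuous_gradient_avgLoss hL).measurable.norm.pow_const 2
  have hβ1 : β ≤ 1 := by nlinarith [mul_pos hγ hL0]
  have hT0 : (0 : ℝ) < T := by exact_mod_cast hT
  have hcard : (0 : ℝ) < p.S.card := by exact_mod_cast (p.nonempty_S hn hf).card_pos
  have hpath := fun ω => (htraj ω).sum_sq_gradient_le hQ hG hb hi
  have hκ0 := fun ω => (htraj ω).coeff_nonneg
  rw [← hκ] at hκ0
  simp only [← hκ, ← p.card_S_eq] at hpath
  rw [← p.card_S_eq]
  set c := κ / 2 + 48 * (13 * (f / (p.S.card : ℝ))) * (κ + 1)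
    + 8 * L ^ 2 * p.S.card * κ * γ ^ 2 with hc
  -- Some sample path is needed, since the sign of `κ` is read off from a trajectory.
  obtain ⟨ω₀⟩ := P.nonempty_of_neZero
  have hc0 : 0 ≤ c := by
    have := hκ0 ω₀
    positivity
  set A : ℕ → Ω → ℝ := fun t ω =>
    ‖mean p.S (fun i => ema β (fun s => e.noise s i ω) (t + 1))‖ ^ 2 with hA
  set N : ℕ → Ω → ℝ := fun t ω =>
    (p.S.card : ℝ)⁻¹ * ∑ i ∈ p.S, ‖ema β (fun s => e.noise s i ω) (t + 1)‖ ^ 2 with hN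
  replace hpath : ∀ ω, ∑ t ∈ Finset.range T, ‖gradient p.avgLoss (e.model t i ω)‖ ^ 2
      ≤ (6 * p.gap θ₀ / γ + 6 * ∑ t ∈ Finset.range T, A t ω)
        + c * (∑ t ∈ Finset.range T, N t ω + 2 * T * ζ ^ 2) := hpath
  have hAi : ∀ t ∈ Finset.range T, Integrable (A t) P ∧
      ∫ ω, A t ω ∂P ≤ (1 - β) * ((p.S.card : ℝ)⁻¹ * σ ^ 2) := fun t ht =>
    e.integral_sq_norm_mean_ema_noise_le hL0.le hL hσ h0 hβ1
      (Nat.succ_le_of_lt (Finset.mem_range.1 ht))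
  have hNi : ∀ t ∈ Finset.range T, Integrable (N t) P ∧ ∫ ω, N t ω ∂P ≤ (1 - β) * σ ^ 2 :=
    fun t ht => by
      have h2 := fun j (hj : j ∈ p.S) => e.integral_sq_norm_ema_noise_node_le hL0.le hL hσ h0 hβ1
        hj (Nat.succ_le_of_lt (Finset.mem_range.1 ht))
      refine ⟨(integrable_finsetSum _ fun j hj => (h2 j hj).1).const_mul _, ?_⟩
      rw [hN, integral_const_mul, integral_finsetSum _ fun j hj => (h2 j hj).1,
        inv_mul_le_iff₀ hcard]
      refine (Finset.sum_le_sum fun j hj => (h2 j hj).2).trans_eq ?_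
      simp
  have hAs := integrable_finsetSum (Finset.range T) fun t ht => (hAi t ht).1
  have hNs := integrable_finsetSum (Finset.range T) fun t ht => (hNi t ht).1
  have hconst := integrable_const (μ := P) (6 * p.gap θ₀ / γ)
  have hE : Integrable (fun ω => c * (∑ t ∈ Finset.range T, N t ω + 2 * T * ζ ^ 2)) P :=
    (hNs.add (integrable_const _)).const_mul c
  have hR : Integrable (fun ω => 6 * p.gap θ₀ / γ + 6 * ∑ t ∈ Finset.range T, A t ω) P :=
    hconst.add (hAs.const_mul 6)
  have hint : ∀ t < T, Integrable (fun ω => ‖gradient p.avgLoss (e.model t i ω)‖ ^ 2) P :=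
    fun t ht => by
      refine (hR.add hE).mono' (hGm.comp ((e.model_measurable t ht.le i hi).mono
        (e.hist.le t) le_rfl)).aestronglyMeasurable (ae_of_all _ fun ω => ?_)
      rw [Real.norm_of_nonneg (by positivity)]
      exact (Finset.single_le_sum (f := fun t => ‖gradient p.avgLoss (e.model t i ω)‖ ^ 2)
        (fun _ _ => by positivity) (Finset.mem_range.2 ht)).trans (hpath ω)
  obtain ⟨hout, hval⟩ := e.integral_output hi hGm hint
  refine ⟨hout, ?_⟩
  rw [hval, ← integral_finsetSum _ fun t ht => hint t (Finset.mem_range.1 ht)]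
  have hmono := integral_mono
    (integrable_finsetSum _ fun t ht => hint t (Finset.mem_range.1 ht)) (hR.add hE) hpath
  have hAT : ∑ t ∈ Finset.range T, ∫ ω, A t ω ∂P
      ≤ T * ((1 - β) * ((p.S.card : ℝ)⁻¹ * σ ^ 2)) := by
    refine (Finset.sum_le_sum fun t ht => (hAi t ht).2).trans_eq ?_
    simp
  have hNT : ∑ t ∈ Finset.range T, ∫ ω, N t ω ∂P ≤ T * ((1 - β) * σ ^ 2) := by
    refine (Finset.sum_le_sum fun t ht => (hNi t ht).2).trans_eq ?_
    simp
  have hval2 : ∫ ω, ((6 * p.gap θ₀ / γ + 6 * ∑ t ∈ Finset.range T, A t ω)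
      + c * (∑ t ∈ Finset.range T, N t ω + 2 * T * ζ ^ 2)) ∂P
      = 6 * p.gap θ₀ / γ + 6 * ∑ t ∈ Finset.range T, ∫ ω, A t ω ∂P
        + c * (∑ t ∈ Finset.range T, ∫ ω, N t ω ∂P + 2 * T * ζ ^ 2) := by
    rw [integral_add hR hE, integral_add hconst (hAs.const_mul 6), integral_const_mul,
      integral_const_mul, integral_add hNs (integrable_const _),
      integral_finsetSum _ fun t ht => (hAi t ht).1, integral_finsetSum _ fun t ht => (hNi t ht).1]
    simp
  rw [inv_mul_le_iff₀ hT0]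
  refine (hmono.trans_eq hval2).trans ?_
  have h3 : (T : ℝ) * (6 * p.gap θ₀ / (γ * T)) = 6 * p.gap θ₀ / γ := by
    field_simp
  have h4 := mul_le_mul_of_nonneg_left hNT hc0
  rw [mul_add, mul_add, mul_add, h3]
  linarith

end Execution

/-! ### Size of the constants and tuning of the learning rate. -/

section Parameters

variable {n f T : ℕ} {L σ ζ Δ : ℝ}

theorem card_bounds (hn : 1 ≤ n) (hf : 11 * f ≤ n) :
    0 < (n : ℝ) - f ∧ 10 * (f : ℝ) ≤ (n : ℝ) - f ∧ 10 * (n : ℝ) ≤ 11 * ((n : ℝ) - f) ∧ (1 : ℝ) ≤ n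
      ∧ (0 : ℝ) ≤ f := by
  have h1 : (1 : ℝ) ≤ n := by exact_mod_cast hn
  have h2 : (11 : ℝ) * f ≤ n := by exact_mod_cast hf
  have h3 : (0 : ℝ) ≤ f := Nat.cast_nonneg f
  refine ⟨?_, ?_, ?_, h1, h3⟩ <;> linarith

theorem alpha_bounds (hn : 1 ≤ n) (hf : 11 * f ≤ n) : 0 ≤ alpha n f ∧ alpha n f ≤ 0.988 := by
  obtain ⟨h1, h2, -, -, h5⟩ := card_bounds hn hf
  refine ⟨by unfold alpha; positivity, ?_⟩
  rw [alpha, div_le_iff₀ h1]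
  linarith

/-- `c₁` is comparable to `f/(n-f)` because `α ≤ 0.988` keeps `(1-α)²` above `0.012² = 0.000144`. -/
theorem c₁_bounds (hn : 1 ≤ n) (hf : 11 * f ≤ n) :
    177 * (f / ((n : ℝ) - f)) ≤ c₁ n f ∧ c₁ n f ≤ 2700000 * (f / ((n : ℝ) - f)) := by
  obtain ⟨h1, h2, -, -, h5⟩ := card_bounds hn hf
  obtain ⟨ha0, ha1⟩ := alpha_bounds hn hf
  have hα : alpha n f = 9.88 * (f / ((n : ℝ) - f)) := by rw [alpha, mul_div_assoc]
  have hpos : 0 < (1 - alpha n f) ^ 2 := by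
    have : 0 < 1 - alpha n f := by linarith
    positivity
  have hle : (1 - alpha n f) ^ 2 ≤ 1 := by nlinarith
  have hge : 0.000144 ≤ (1 - alpha n f) ^ 2 := by nlinarith
  have hw : 0 ≤ (f : ℝ) / ((n : ℝ) - f) := by positivity
  rw [c₁, div_le_iff₀ hpos, le_div_iff₀ hpos]
  constructor
  · calc 177 * (f / ((n : ℝ) - f)) * (1 - alpha n f) ^ 2
        ≤ 177 * (f / ((n : ℝ) - f)) * 1 := by gcongr
      _ ≤ 18 * alpha n f * 1 := by rw [hα]; linarith
      _ ≤ 18 * alpha n f * (1 + alpha n f) := by gcongr; linarith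
  · calc 18 * alpha n f * (1 + alpha n f) ≤ 18 * alpha n f * 1.988 := by gcongr; linarith
      _ ≤ 2700000 * (f / ((n : ℝ) - f)) * 0.000144 := by rw [hα]; linarith
      _ ≤ _ := by gcongr

theorem ratio_bounds (hn : 1 ≤ n) (hf : 11 * f ≤ n) :
    0 ≤ (f : ℝ) / ((n : ℝ) - f) ∧ (f : ℝ) / ((n : ℝ) - f) ≤ 0.1 ∧
      (f : ℝ) / n ≤ f / ((n : ℝ) - f) ∧ (f : ℝ) / ((n : ℝ) - f) ≤ 1.1 * (f / n) ∧
      1 / (n : ℝ) ≤ ((n : ℝ) - f)⁻¹ ∧ ((n : ℝ) - f)⁻¹ ≤ 1.1 * (1 / n) := by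
  obtain ⟨h1, h2, h3, h4, h5⟩ := card_bounds hn hf
  have hn0 : (0 : ℝ) < n := by linarith
  have h6 : ((n : ℝ) - f)⁻¹ ≤ 1.1 * (1 / n) := by
    rw [mul_one_div, inv_le_iff_one_le_mul₀ h1, div_mul_eq_mul_div, le_div_iff₀ hn0]
    linarith
  have h7 : 1 / (n : ℝ) ≤ ((n : ℝ) - f)⁻¹ := by
    rw [one_div]; exact inv_anti₀ h1 (by linarith)
  refine ⟨by positivity, ?_, ?_, ?_, h7, h6⟩
  · rw [div_le_iff₀ h1]; linarith
  · rw [div_eq_mul_one_div, div_eq_mul_inv (f : ℝ)]; gcongr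
  · rw [div_eq_mul_inv, div_eq_mul_one_div (f : ℝ) n]
    nlinarith

/-- Both directions are needed: the upper bound controls the optimization term `Δ/(γT)`, the lower
one the noise term proportional to `γ`. -/
theorem c₂_bounds (hn : 1 ≤ n) (hf : 11 * f ≤ n) (hL : 0 < L) :
    216 * (L * ((1 + f) / n)) ≤ c₂ n f L ∧ c₂ n f L ≤ 3000000000 * (L * ((1 + f) / n)) := by
  obtain ⟨hw0, hw1, hw2, hw3, hi0, hi1⟩ := ratio_bounds hn hf
  obtain ⟨hc0, hc1⟩ := c₁_bounds hn hf
  obtain ⟨h1, h2, h3, h4, h5⟩ := card_bounds hn hf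
  have hlam : lam n f = 9 * (f / ((n : ℝ) - f)) := by rw [lam, mul_div_assoc]
  have hv : (1 + f : ℝ) / n = 1 / n + f / n := add_div _ _ _
  have hinv : 3 / ((n : ℝ) - f) = 3 * ((n : ℝ) - f)⁻¹ := div_eq_mul_inv _ _
  set w := (f : ℝ) / ((n : ℝ) - f)
  have hf0 : 0 ≤ (f : ℝ) / n := by positivity
  have hn1 : 0 ≤ 1 / (n : ℝ) := by positivity
  have hprod : 9 * lam n f / 2 * (2 * c₁ n f + 3) ≤ 22000000 * w := by
    rw [hlam]
    have : 2 * c₁ n f + 3 ≤ 540003 := by linarith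
    nlinarith
  have hprod0 : 0 ≤ 9 * lam n f / 2 * (2 * c₁ n f + 3) := by
    rw [hlam]
    have : 0 ≤ 2 * c₁ n f + 3 := by linarith
    positivity
  rw [c₂, hv, hinv]
  constructor
  · have : 3 * (1 / (n : ℝ) + f / n)
        ≤ 3 * ((n : ℝ) - f)⁻¹ + 2 * c₁ n f + 9 * lam n f / 2 * (2 * c₁ n f + 3) := by linarith
    nlinarith
  · have : 3 * ((n : ℝ) - f)⁻¹ + 2 * c₁ n f + 9 * lam n f / 2 * (2 * c₁ n f + 3)
        ≤ 40000000 * (1 / (n : ℝ) + f / n) := by linarith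
    have h6 : 0 ≤ L * (1 / (n : ℝ) + f / n) := by positivity
    nlinarith

/-- The reciprocal of a minimum is at most the sum of the reciprocals. The cap with `c₁` gives the
condition `small` for `κ = c₁/9`: its left side is at most `4/9 · 2/3 < 1/2`. -/
theorem learningRate_bounds (hn : 1 ≤ n) (hf : 11 * f ≤ n) (hL : 0 < L) (hσ : 0 < σ) (hΔ : 0 < Δ)
    (hT : 1 ≤ T) :
    0 < learningRate n f L σ Δ T ∧ 12 * learningRate n f L σ Δ T * L ≤ 1 ∧
      4 * L ^ 2 * (c₁ n f / 9) * learningRate n f L σ Δ T ^ 2 ≤ 1 / 2 ∧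
      learningRate n f L σ Δ T ≤ √(12 * Δ / (c₂ n f L * L * T * σ ^ 2)) ∧
      1 / learningRate n f L σ Δ T ≤ 12 * L + L * √(3 * c₁ n f / 2)
        + 1 / √(12 * Δ / (c₂ n f L * L * T * σ ^ 2)) := by
  obtain ⟨h1, h2, h3, h4, h5⟩ := card_bounds hn hf
  have hc2 : 0 < c₂ n f L :=
    lt_of_lt_of_le (by positivity) (c₂_bounds hn hf hL).1
  have hT0 : (0 : ℝ) < T := by exact_mod_cast hT
  set s := √(12 * Δ / (c₂ n f L * L * T * σ ^ 2)) with hs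
  have hs0 : 0 < s := Real.sqrt_pos.2 (by positivity)
  have hL12 : 0 < 1 / (12 * L) := by positivity
  have hsi : 0 < 1 / s := by positivity
  have hL12' : 1 / (1 / (12 * L)) = 12 * L := one_div_one_div _
  have hr0 : 0 ≤ L * √(3 * c₁ n f / 2) := by positivity
  have hstep : ∀ x, x ≤ 1 / (12 * L) → 12 * x * L ≤ 1 := fun x hx => by
    rw [le_div_iff₀ (by positivity)] at hx
    linarith
  rw [learningRate, ← hs]
  split_ifs with hf0
  · have hc1 : c₁ n f = 0 := by simp [c₁, alpha, hf0]
    refine ⟨lt_min hL12 hs0, hstep _ (min_le_left _ _), ?_, min_le_right _ _, ?_⟩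
    · simp [hc1]
    · rcases min_choice (1 / (12 * L)) s with h | h <;> rw [h] <;> linarith
  · have hw : (0 : ℝ) < f / ((n : ℝ) - f) := by
      have : (0 : ℝ) < f := by exact_mod_cast Nat.pos_of_ne_zero hf0
      positivity
    have hc1 : 0 < c₁ n f := lt_of_lt_of_le (by positivity) (c₁_bounds hn hf).1
    set r := 1 / L * √(2 / (3 * c₁ n f)) with hr
    have hrpos : 0 < r := mul_pos (by positivity) (Real.sqrt_pos.2 (by positivity))
    have hri : 1 / r = L * √(3 * c₁ n f / 2) := by
      rw [hr, ← inv_div (2 : ℝ), Real.sqrt_inv]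
      field_simp
    have hrsq : L ^ 2 * r ^ 2 * c₁ n f = 2 / 3 := by
      rw [hr, mul_pow, Real.sq_sqrt (by positivity)]
      field_simp
    have hpos : 0 < min (1 / (12 * L)) (min r s) := lt_min hL12 (lt_min hrpos hs0)
    have hler : min (1 / (12 * L)) (min r s) ≤ r := (min_le_right _ _).trans (min_le_left _ _)
    refine ⟨hpos, hstep _ (min_le_left _ _), ?_, (min_le_right _ _).trans (min_le_right _ _), ?_⟩
    · have h6 : min (1 / (12 * L)) (min r s) ^ 2 ≤ r ^ 2 := by gcongr
      have h7 := mul_le_mul_of_nonneg_left h6 (show 0 ≤ L ^ 2 * c₁ n f by positivity)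
      linarith
    · rcases min_choice (1 / (12 * L)) (min r s) with h | h
      · rw [h]; linarith
      · rw [h]
        rcases min_choice r s with h' | h' <;> rw [h'] <;> linarith

/-- This is `y/2 ≤ 1 - √(1-y) ≤ y` on `[0, 1]`, with `y = 12γL`. -/
theorem momentumCoeff_bounds (h0 : 0 ≤ learningRate n f L σ Δ T * L)
    (h1 : 12 * learningRate n f L σ Δ T * L ≤ 1) :
    0 ≤ momentumCoeff n f L σ Δ T ∧
      6 * learningRate n f L σ Δ T * L ≤ 1 - momentumCoeff n f L σ Δ T ∧
      1 - momentumCoeff n f L σ Δ T ≤ 12 * learningRate n f L σ Δ T * L := by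
  rw [momentumCoeff]
  set x := learningRate n f L σ Δ T * L with hx
  refine ⟨Real.sqrt_nonneg _, ?_, ?_⟩
  · have : √(1 - 12 * learningRate n f L σ Δ T * L) ≤ 1 - 6 * x :=
      Real.sqrt_le_iff.2 ⟨by linarith, by rw [mul_assoc, ← hx]; nlinarith⟩
    linarith
  · have : 1 - 12 * x ≤ √(1 - 12 * learningRate n f L σ Δ T * L) :=
      Real.le_sqrt_of_sq_le (by rw [mul_assoc, ← hx]; nlinarith)
    linarith

/-- The bound of the convergence theorem, for the prescribed parameters. -/
theorem convergence_bound_le (hn : 1 ≤ n) (hf : 11 * f ≤ n) (hL : 0 < L) (hσ : 0 < σ)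
    (hΔ : 0 < Δ) (hT : 1 ≤ T) {γ b κ : ℝ} (hγ : γ = learningRate n f L σ Δ T)
    (hb0 : 0 ≤ b) (hb : b ≤ 12 * γ * L) (hκ : κ = c₁ n f / 9) :
    6 * Δ / (γ * T) + 6 * (b * (((n : ℝ) - f)⁻¹ * σ ^ 2))
        + (κ / 2 + 48 * (13 * (f / ((n : ℝ) - f))) * (κ + 1)
            + 8 * L ^ 2 * ((n : ℝ) - f) * κ * γ ^ 2) * (b * σ ^ 2 + 2 * ζ ^ 2)
      ≤ (6 * (L * √(250000000 * Δ)) + 300000000 * √(Δ / 18) + 50000000)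
          * (√(σ ^ 2 / T * ((1 + f) / n)) + f / n * ζ ^ 2)
        + (6 * Δ * (12 * L + L * √(3 * c₁ n f / 2)) + 8 * L ^ 2 * ((n : ℝ) - f) * κ
          * (12 * Δ / (c₂ n f L * L * σ ^ 2)) * (σ ^ 2 + 2 * ζ ^ 2)) / T := by
  obtain ⟨hw0, hw1, hw2, hw3, hi0, hi1⟩ := ratio_bounds hn hf
  obtain ⟨hc0, hc1⟩ := c₁_bounds hn hf
  obtain ⟨h1, h2, h3, h4, h5⟩ := card_bounds hn hf
  obtain ⟨hd0, hd1⟩ := c₂_bounds hn hf hL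
  obtain ⟨hγ0, hγ1, -, hγs, hγi⟩ := learningRate_bounds hn hf hL hσ hΔ hT
  rw [← hγ] at hγ0 hγ1 hγs hγi
  have hT0 : (0 : ℝ) < T := by exact_mod_cast hT
  have hn0 : (0 : ℝ) < n := by linarith
  set w := (f : ℝ) / ((n : ℝ) - f)
  set v := (1 + f : ℝ) / n with hv
  have hv0 : 0 < v := by positivity
  have hc2 : 0 < c₂ n f L := lt_of_lt_of_le (by positivity) hd0
  set R := √(σ ^ 2 / T * v) with hR
  have hR0 : 0 ≤ R := Real.sqrt_nonneg _
  have hRsq : R ^ 2 = σ ^ 2 / T * v := Real.sq_sqrt (by positivity)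
  set s := √(12 * Δ / (c₂ n f L * L * T * σ ^ 2)) with hs
  have hs0 : 0 < s := Real.sqrt_pos.2 (by positivity)
  have hssq : s ^ 2 = 12 * Δ / (c₂ n f L * L * T * σ ^ 2) := Real.sq_sqrt (by positivity)
  have hκ0 : 0 ≤ κ := by rw [hκ]; linarith
  have hκ1 : κ ≤ 300000 * w := by rw [hκ]; linarith
  -- the optimization term
  have hopt : Δ / (s * T) ≤ L * √(250000000 * Δ) * R := by
    refine le_of_sq_le_sq ?_ (by positivity)
    rw [div_pow, mul_pow, mul_pow, mul_pow, hssq, hRsq, Real.sq_sqrt (by positivity)]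
    have e : Δ ^ 2 / (12 * Δ / (c₂ n f L * L * T * σ ^ 2) * T ^ 2)
        = c₂ n f L * (Δ * L * σ ^ 2 / (12 * T)) := by
      field_simp
    rw [e]
    refine (mul_le_mul_of_nonneg_right hd1 (by positivity)).trans_eq ?_
    field_simp
    norm_num
  have hterm1 : 6 * Δ / (γ * T) ≤ 6 * Δ * (12 * L + L * √(3 * c₁ n f / 2)) / T
      + 6 * (L * √(250000000 * Δ) * R) := by
    have e : 6 * Δ / (γ * T) = 6 * Δ / T * (1 / γ) := by field_simp
    have e2 : 6 * Δ / T * (1 / s) = 6 * (Δ / (s * T)) := by field_simp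
    have e3 : 6 * Δ * (12 * L + L * √(3 * c₁ n f / 2)) / T
        = 6 * Δ / T * (12 * L + L * √(3 * c₁ n f / 2)) := by field_simp
    have := mul_le_mul_of_nonneg_left hγi (show 0 ≤ 6 * Δ / T by positivity)
    rw [mul_add, e2] at this
    rw [e, e3]
    linarith
  -- the noise term
  have hnoise : L * γ * σ ^ 2 * v ≤ √(Δ / 18) * R := by
    refine le_of_sq_le_sq ?_ (by positivity)
    have h6 : (L * γ * σ ^ 2 * v) ^ 2 ≤ (L * s * σ ^ 2 * v) ^ 2 := by gcongr
    refine h6.trans ?_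
    rw [mul_pow, mul_pow, mul_pow, mul_pow, hssq, hRsq, Real.sq_sqrt (by positivity)]
    have e : L ^ 2 * (12 * Δ / (c₂ n f L * L * T * σ ^ 2)) * (σ ^ 2) ^ 2 * v ^ 2
        = 12 * Δ * L * σ ^ 2 * v ^ 2 / T / c₂ n f L := by field_simp
    rw [e, div_le_iff₀ hc2]
    refine le_trans (le_of_eq ?_) (mul_le_mul_of_nonneg_left hd0 (by positivity))
    field_simp
    norm_num
  have hvexp : v = 1 / n + f / n := add_div _ _ _
  have hfn : 0 ≤ (f : ℝ) / n := by positivity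
  have hn1 : 0 ≤ 1 / (n : ℝ) := by positivity
  have hcoef : κ / 2 + 48 * (13 * w) * (κ + 1) ≤ 19000000 * w := by
    have : κ + 1 ≤ 30001 := by linarith
    nlinarith
  have hcoef0 : 0 ≤ κ / 2 + 48 * (13 * w) * (κ + 1) := by positivity
  have hbσ : b * σ ^ 2 ≤ 12 * (L * γ * σ ^ 2) := by
    have := mul_le_mul_of_nonneg_right hb (sq_nonneg σ)
    linarith
  have hbσ0 : 0 ≤ b * σ ^ 2 := by positivity
  have hterm2 : 6 * (b * (((n : ℝ) - f)⁻¹ * σ ^ 2))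
      + (κ / 2 + 48 * (13 * w) * (κ + 1)) * (b * σ ^ 2) ≤ 300000000 * (√(Δ / 18) * R) := by
    have h6 : 6 * ((n : ℝ) - f)⁻¹ + (κ / 2 + 48 * (13 * w) * (κ + 1)) ≤ 25000000 * v := by
      rw [hvexp]; linarith
    calc 6 * (b * (((n : ℝ) - f)⁻¹ * σ ^ 2)) + (κ / 2 + 48 * (13 * w) * (κ + 1)) * (b * σ ^ 2)
        = (6 * ((n : ℝ) - f)⁻¹ + (κ / 2 + 48 * (13 * w) * (κ + 1))) * (b * σ ^ 2) := by ring
      _ ≤ 25000000 * v * (12 * (L * γ * σ ^ 2)) := by gcongr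
      _ = 300000000 * (L * γ * σ ^ 2 * v) := by ring
      _ ≤ _ := by gcongr
  have hterm3 : (κ / 2 + 48 * (13 * w) * (κ + 1)) * (2 * ζ ^ 2) ≤ 50000000 * (f / n * ζ ^ 2) := by
    have h6 : κ / 2 + 48 * (13 * w) * (κ + 1) ≤ 25000000 * (f / n) := by linarith
    have := mul_le_mul_of_nonneg_right h6 (show 0 ≤ 2 * ζ ^ 2 by positivity)
    linarith
  -- Higher order: `γ² ≤ s²`, which is proportional to `1/T`, and `b ≤ 1`.
  have hterm4 : 8 * L ^ 2 * ((n : ℝ) - f) * κ * γ ^ 2 * (b * σ ^ 2 + 2 * ζ ^ 2)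
      ≤ 8 * L ^ 2 * ((n : ℝ) - f) * κ
          * (12 * Δ / (c₂ n f L * L * σ ^ 2)) * (σ ^ 2 + 2 * ζ ^ 2) / T := by
    have h6 : γ ^ 2 ≤ s ^ 2 := by gcongr
    have h7 : b * σ ^ 2 ≤ σ ^ 2 := mul_le_of_le_one_left (sq_nonneg σ) (by linarith)
    have h8 : s ^ 2 = 12 * Δ / (c₂ n f L * L * σ ^ 2) / T := by
      rw [hssq]; field_simp
    calc 8 * L ^ 2 * ((n : ℝ) - f) * κ * γ ^ 2 * (b * σ ^ 2 + 2 * ζ ^ 2)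
        ≤ 8 * L ^ 2 * ((n : ℝ) - f) * κ * s ^ 2 * (σ ^ 2 + 2 * ζ ^ 2) := by gcongr
      _ = _ := by rw [h8]; ring
  have hrest1 : 0 ≤ (6 * (L * √(250000000 * Δ)) + 300000000 * √(Δ / 18)) * (f / n * ζ ^ 2) := by
    positivity
  rw [add_div]
  linarith

end Parameters

/-! ### Zero learning rate. -/

section Degenerate

variable {n f : ℕ} {p : Problem.{u} n f} {θ₀ : Param p.d} {β γ : ℝ} {T : ℕ} {Ω : Type v}
  [MeasurableSpace Ω] {P : Measure Ω}

/-- When all correct vectors coincide their spread is zero, so averaging leaves them in place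
despite the faulty ones. This handles `Δ = 0`, where the prescribed rate vanishes. -/
theorem Execution.model_eq_of_zero_rate (e : Execution p θ₀ β γ 1 T P) (hγ : γ = 0)
    (hn : 1 ≤ n) (hf : 11 * f ≤ n) (ω : Ω) {t : ℕ} (ht : t ≤ T) {i : Fin n} (hi : i ∈ p.S) :
    e.model t i ω = θ₀ := by
  subst hγ
  have hne := p.nonempty_S hn hf
  induction t generalizing i with
  | zero => exact e.model_zero i hi ω
  | succ t ih =>
    have ht' : t < T := by omega
    have hx : ∀ j ∈ p.S, e.vec t 0 j ω = θ₀ := fun j hj => by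
      rw [e.vec_zero t ht' j hj, zero_smul, sub_zero, ih (by omega) hj]
    have hR : ∀ j ∈ p.S, j ∉ e.received t 0 j ω ∧ (e.received t 0 j ω).card = n - f - 1 :=
      fun j hj => e.received_card t ht' 0 one_pos j hj ω
    have hnna : ∀ j ∈ p.S, IsNNA n f (e.vec t 0 j ω) (fun k => e.vec t 0 k ω)
        (e.received t 0 j ω) (e.model (t + 1) j ω) := fun j hj => by
      rw [e.model_succ t ht' j hj]
      exact e.vec_succ t ht' 0 one_pos j hj ω
    have hs0 : spread p.S (fun k => e.vec t 0 k ω) = 0 := by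
      rw [spread_congr hx]; simp [spread, mean_const hne]
    have hs := nna_spread_le hn hf p.card_S hR hnna
    have hm := nna_mean_sq_le hn hf p.card_S hR hnna
    rw [hs0, mul_zero] at hs hm
    rw [mean_congr hx, mean_const hne] at hm
    have h1 := norm_sub_mean_sq_le hi (fun k => e.model (t + 1) k ω)
    have h2 : (p.S.card : ℝ) * spread p.S (fun k => e.model (t + 1) k ω) ≤ 0 :=
      mul_nonpos_of_nonneg_of_nonpos (by positivity) hs
    have h3 : ∀ v : Param p.d, ‖v‖ ^ 2 ≤ 0 → v = 0 := fun v hv => by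
      simpa using le_antisymm hv (sq_nonneg ‖v‖)
    rw [sub_eq_zero.1 (h3 _ (h1.trans h2)), sub_eq_zero.1 (h3 _ hm)]

end Degenerate

/-! ### Assembly of the guarantees. -/

theorem MonnaGuarantee.mono {n f T : ℕ} {L σ ζ Δ ε ε' : ℝ}
    (h : MonnaGuarantee.{u, v} n f L σ ζ Δ T ε) (hε : ε ≤ ε') :
    MonnaGuarantee.{u, v} n f L σ ζ Δ T ε' := fun p θ₀ hL hσ hζ hb hΔ Ω _ P _ e i hi =>
  ⟨(h p θ₀ hL hσ hζ hb hΔ Ω P e i hi).1, (h p θ₀ hL hσ hζ hb hΔ Ω P e i hi).2.trans hε⟩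

/-- Convergence of MoNNA with an explicit leading constant. -/
theorem exists_monnaGuarantee {L Δ : ℝ} (hL : 0 < L) {n f : ℕ} {σ ζ : ℝ} (hn : 1 ≤ n)
    (hf : 11 * f ≤ n) (hσ : 0 < σ) :
    ∃ C' : ℝ, 0 ≤ C' ∧ ∀ T : ℕ, 1 ≤ T → MonnaGuarantee.{u, v} n f L σ ζ Δ T
      ((6 * (L * √(250000000 * Δ)) + 300000000 * √(Δ / 18) + 50000000)
        * (√(σ ^ 2 / T * ((1 + f) / n)) + f / n * ζ ^ 2) + C' / T) := by
  rcases lt_trichotomy Δ 0 with hΔ | rfl | hΔ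
  -- The gap is never negative, so this case is vacuous.
  · refine ⟨0, le_rfl, fun T _ p θ₀ _ _ _ hb hgap => ?_⟩
    have : 0 ≤ p.gap θ₀ := sub_nonneg.2 (ciInf_le hb θ₀)
    linarith
  · refine ⟨0, le_rfl, fun T hT p θ₀ hLip hvar hhet hb hgap Ω _ P _ e i hi => ?_⟩
    have hrate : learningRate n f L σ 0 T = 0 := by
      have h12 : 0 ≤ 1 / (12 * L) := by positivity
      rw [learningRate]
      have hr : 0 ≤ 1 / L * √(2 / (3 * c₁ n f)) := by positivity
      simp only [mul_zero, zero_div, Real.sqrt_zero, min_eq_right h12, min_eq_right hr, ite_self]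
    -- With zero gap the start is a minimizer, and no model ever leaves it.
    have hgrad : ‖gradient p.avgLoss θ₀‖ ^ 2 ≤ 0 := by
      have h1 : ∀ x y, ‖gradient p.avgLoss x - gradient p.avgLoss y‖ ≤ L * ‖x - y‖ := fun x y => by
        have hc : (0 : ℝ) < p.S.card := by exact_mod_cast (p.nonempty_S hn hf).card_pos
        rw [Problem.gradient_avgLoss hLip, Problem.gradient_avgLoss hLip, ← mean_sub, mean,
          norm_smul, norm_inv, Real.norm_of_nonneg hc.le, inv_mul_le_iff₀ hc]
        refine (norm_sum_le_of_le p.S fun j hj => (hLip j hj).2 x y).trans_eq ?_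
        simp
      have := sq_norm_gradient_le (Problem.differentiable_avgLoss hLip) hL h1 hb θ₀
      rw [← Problem.gap, hgap, mul_zero] at this
      exact this
    have hout : ∀ ω, ‖gradient p.avgLoss (e.output i ω)‖ ^ 2 = 0 := fun ω => by
      rw [Execution.output, e.model_eq_of_zero_rate hrate hn hf ω (e.outIdx i ω).2.le hi]
      exact le_antisymm hgrad (sq_nonneg _)
    simp only [hout, integral_zero]
    exact ⟨integrable_zero _ _ _, by positivity⟩
  · obtain ⟨hd0, -⟩ := c₂_bounds hn hf hL
    obtain ⟨h1, h2, h3, h4, h5⟩ := card_bounds hn hf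
    have hc2 : 0 < c₂ n f L := lt_of_lt_of_le (by positivity) hd0
    have hc1 : 0 ≤ c₁ n f := le_trans (by positivity) (c₁_bounds hn hf).1
    refine ⟨6 * Δ * (12 * L + L * √(3 * c₁ n f / 2)) + 8 * L ^ 2 * ((n : ℝ) - f) * (c₁ n f / 9)
      * (12 * Δ / (c₂ n f L * L * σ ^ 2)) * (σ ^ 2 + 2 * ζ ^ 2), by positivity,
      fun T hT p θ₀ hLip hvar hhet hb hgap Ω _ P _ e i hi => ?_⟩
    obtain ⟨hγ0, hγ1, hγ2, -, -⟩ := learningRate_bounds hn hf hL hσ hΔ hT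
    obtain ⟨hβ0, hβ1, hβ2⟩ := momentumCoeff_bounds (mul_pos hγ0 hL).le hγ1
    have hκ : c₁ n f / 9 = 2 * alpha n f * (1 + alpha n f) / (1 - alpha n f) ^ 2 := by
      rw [c₁]; ring
    have hα : alpha n f < 1 := (alpha_bounds hn hf).2.trans_lt (by norm_num)
    obtain ⟨hint, hle⟩ := e.integral_sq_gradient_output_le hn hf hT hL hLip hvar hhet hb hγ0 hγ1
      hβ0 hβ1 hα (hκ ▸ hγ2) hκ hi
    refine ⟨hint, hle.trans ?_⟩
    rw [hgap]
    exact convergence_bound_le hn hf hL hσ hΔ hT rfl (by linarith [mul_pos hγ0 hL]) hβ2 rfl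

end Monna

theorem corollary1 (L Δ : ℝ) (hL : 0 < L) :
    ∃ C : ℝ, 0 < C ∧
      ∀ (n f : ℕ) (σ ζ : ℝ), 1 ≤ n → 11 * f ≤ n → 0 < σ → 0 ≤ ζ →
        (∃ C' : ℝ, ∀ T : ℕ, 1 ≤ T →
          Monna.MonnaGuarantee.{u, v} n f L σ ζ Δ T
            (C * (√(σ ^ 2 / T * ((1 + f) / n)) + f / n * ζ ^ 2) + C' / T)) ∧
        (∃ T₀ : ℕ, 1 ≤ T₀ ∧ ∀ T : ℕ, T₀ ≤ T →
          Monna.MonnaGuarantee.{u, v} n f L σ ζ Δ T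
            (C * (√(σ ^ 2 / T * ((1 + f) / n)) + f / n * ζ ^ 2)) ∧
          Monna.MonnaGuarantee.{u, v} n f L σ ζ Δ ((1 + f) * T)
            (C * (√(σ ^ 2 / (n * T)) + f / n * ζ ^ 2))) := by
  obtain ⟨C₀, hC₀, hC⟩ : ∃ C₀ : ℝ, 0 ≤ C₀ ∧
      C₀ = 6 * (L * √(250000000 * Δ)) + 300000000 * √(Δ / 18) + 50000000 :=
    ⟨_, by positivity, rfl⟩
  -- The extra `1` absorbs `C'/T` for large `T`.
  refine ⟨C₀ + 1, by linarith, fun n f σ ζ hn hf hσ _ => ?_⟩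
  obtain ⟨C', hC', h⟩ := Monna.exists_monnaGuarantee.{u, v} (Δ := Δ) (ζ := ζ) hL hn hf hσ
  rw [← hC] at h
  have hn0 : (0 : ℝ) < n := by exact_mod_cast hn
  refine ⟨⟨C', fun T hT => (h T hT).mono ?_⟩, ⌈C' ^ 2 * n / σ ^ 2⌉₊ + 1, by omega, fun T hT => ?_⟩
  · gcongr
    exact le_add_of_nonneg_right zero_le_one
  · have hT1 : 1 ≤ T := by omega
    have hT0 : (0 : ℝ) < T := by exact_mod_cast hT1
    have hz : 0 ≤ f / n * ζ ^ 2 := by positivity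
    -- Squared, this is `T ≥ C'² n / σ²`, whence the choice of `T₀`.
    have hrate : C' / T ≤ √(σ ^ 2 / (n * T)) := by
      refine Real.le_sqrt_of_sq_le ?_
      have h1 : C' ^ 2 * n / σ ^ 2 ≤ T := (Nat.le_ceil _).trans (by exact_mod_cast (by omega))
      rw [div_le_iff₀ (by positivity)] at h1
      rw [div_pow, div_le_div_iff₀ (by positivity) (by positivity)]
      nlinarith
    constructor
    · refine (h T hT1).mono ?_
      have h2 : √(σ ^ 2 / (n * T)) ≤ √(σ ^ 2 / T * ((1 + f) / n)) := by
        refine Real.sqrt_le_sqrt ?_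
        have e : σ ^ 2 / T * ((1 + f) / n) = σ ^ 2 / (n * T) * (1 + f) := by field_simp
        rw [e]
        exact le_mul_of_one_le_right (by positivity) (by linarith [Nat.cast_nonneg (α := ℝ) f])
      linarith
    · refine (h ((1 + f) * T) (by nlinarith)).mono ?_
      -- Running `1 + f` times longer cancels exactly the factor `1 + f` of the rate.
      have e : σ ^ 2 / ((1 + f) * T : ℕ) * ((1 + f) / n) = σ ^ 2 / (n * T) := by
        push_cast; field_simp
      have h3 : C' / ((1 + f) * T : ℕ) ≤ C' / T := by
        gcongr
        nlinarith
      rw [e]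
      linarith
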